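/- Write $\langle x\rangle = 1+|x|$ and, for $F\in\mathcal S(\mathbb R^2)$ (complex-valued Schwartz functions of $(x,t)$), $\widehat F(\xi,\tau)=(2\pi)^{-1}\int_{\mathbb R^2}e^{-i(x\xi+t\tau)}F(x,t)\,dx\,dt$. For $a\neq 0$ and $s,b\in\mathbb R$ let $X^a_{s,b}$ be the completion of $\mathcal S(\mathbb R^2)$ with respect to the norm $$\|F\|_{X^a_{s,b}}=\Big(\int_{\mathbb R}\int_{\mathbb R}\langle\tau+a\xi^3\rangle^{2b}\langle\xi\rangle^{2s}|\widehat F(\xi,\tau)|^2\,d\xi\,d\tau\Big)^{1/2}.$$ **Proposition 3.2.** Given $s>-\frac34$, there exist $b'\in(-\frac12,0)$ and $\epsilon_s>0$ such that for every $b\in(\frac12,b'+1]$ with $b'+1-b\le\epsilon_s$ there is a constant $c=c_{(s,b,b')}>0$ such that $$\|(v\tilde v)_x\|_{X^{1}_{s,b'}}\le c\,\|v\|_{X^{-1}_{s,b}}\|\tilde v\|_{X^{-1}_{s,b}}\qquad\text{for all } v,\tilde v\in X^{-1}_{s,b},$$ $$\|(u\tilde u)_x\|_{X^{-1}_{s,b'}}\le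 c\,\|u\|_{X^{1}_{s,b}}\|\tilde u\|_{X^{1}_{s,b}}\qquad\text{for all } u,\tilde u\in X^{1}_{s,b},$$ $$\|(uv)_x\|_{X^{1}_{s,b'}}\le c\,\|u\|_{X^{1}_{s,b}}\|v\|_{X^{-1}_{s,b}}\qquad\text{for all } u\in X^1_{s,b},\ v\in X^{-1}_{s,b},$$ $$\|(uv)_x\|_{X^{-1}_{s,b'}}\le c\,\|u\|_{X^{1}_{s,b}}\|v\|_{X^{-1}_{s,b}}\qquad\text{for all } u\in X^1_{s,b},\ v\in X^{-1}_{s,b}.$$ In particular $\|(vv)_x\|_{X^1_{s,b'}}\le c\,\|v\|^2_{X^{-1}_{s,b}}$ and $\|(uu)_x\|_{X^{-1}_{s,b'}}\le c\,\|u\|^2_{X^{1}_{s,b}}$. Here, for elements of the completions, $(fg)_x$ denotes the (unique) continuous bilinear extension of $(f,g)\mapsto\partial_x(fg)$ from Schwartz functions; its existence, between the spaces occurring in each estimate, is part of the claim. -/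

import Mathlib

open MeasureTheory
open scoped SchwartzMap FourierTransform LineDeriv

noncomputable section

namespace Bourgain

/-- The bracket `⟨x⟩ = 1 + |x|`. -/
def bracket (x : ℝ) : ℝ := 1 + |x|

/-- The space-time Fourier transform
`F̂(ξ, τ) = (2π)⁻¹ ∫ e^{-i(xξ + tτ)} F(x, t) dx dt`; a point of `ℝ × ℝ` is `(x, t)` on the
physical side and `(ξ, τ)` on the frequency side. -/
def hat (F : 𝓢(ℝ × ℝ, ℂ)) (p : ℝ × ℝ) : ℂ :=
  (2 * (Real.pi : ℂ))⁻¹ *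
    ∫ q : ℝ × ℝ, Complex.exp (-Complex.I * ((q.1 * p.1 + q.2 * p.2 : ℝ) : ℂ)) * F q

/-- The Bourgain norm
`‖F‖_{X^a_{s,b}} = (∫∫ ⟨τ + a ξ³⟩^{2b} ⟨ξ⟩^{2s} |F̂(ξ, τ)|² dξ dτ)^{1/2}` of a Schwartz function. -/
def bourgainNorm (a s b : ℝ) (F : 𝓢(ℝ × ℝ, ℂ)) : ℝ :=
  Real.sqrt (∫ p : ℝ × ℝ,
    bracket (p.2 + a * p.1 ^ 3) ^ (2 * b) * bracket p.1 ^ (2 * s) * ‖hat F p‖ ^ 2)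

/-! ### The Bourgain norm is a seminorm: it is the `L²` norm of the weighted transform -/

lemma one_le_bracket (x : ℝ) : 1 ≤ bracket x := by
  unfold bracket; linarith [abs_nonneg x]

/-- The square root of the weight in the norm. -/
def weight (a s b : ℝ) (p : ℝ × ℝ) : ℝ :=
  bracket (p.2 + a * p.1 ^ 3) ^ b * bracket p.1 ^ s

lemma continuous_weight (a s b : ℝ) : Continuous (weight a s b) := by
  have h (x : ℝ) : bracket x ≠ 0 := by linarith [one_le_bracket x]
  have hc : Continuous bracket := by unfold bracket; fun_prop
  unfold weight
  refine Continuous.mul ?_ ?_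
  · exact (hc.comp (by fun_prop)).rpow_const fun p => Or.inl (h _)
  · exact (hc.comp (by fun_prop)).rpow_const fun p => Or.inl (h _)

lemma weight_sq (a s b : ℝ) (p : ℝ × ℝ) :
    weight a s b p ^ 2 = bracket (p.2 + a * p.1 ^ 3) ^ (2 * b) * bracket p.1 ^ (2 * s) := by
  have h (x : ℝ) : 0 ≤ bracket x := by linarith [one_le_bracket x]
  unfold weight
  rw [mul_pow, mul_comm 2 b, mul_comm 2 s, Real.rpow_mul (h _), Real.rpow_mul (h _)]
  norm_cast

lemma weight_nonneg (a s b : ℝ) (p : ℝ × ℝ) : 0 ≤ weight a s b p := by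
  have h (x : ℝ) : 0 ≤ bracket x := by linarith [one_le_bracket x]
  unfold weight
  exact mul_nonneg (Real.rpow_nonneg (h _) _) (Real.rpow_nonneg (h _) _)

lemma exists_weight_le (a s b : ℝ) :
    ∃ (C : ℝ) (n : ℕ), 0 ≤ C ∧ ∀ p : ℝ × ℝ, weight a s b p ≤ C * (1 + ‖p‖) ^ n := by
  refine ⟨(1 + |a|) ^ |b|, ⌈3 * |b| + |s|⌉₊, by positivity, fun p => ?_⟩
  have h1 : |p.1| ≤ ‖p‖ := norm_fst_le p
  have h2 : |p.2| ≤ ‖p‖ := norm_snd_le p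
  have h0 : 0 ≤ ‖p‖ := norm_nonneg p
  have hA : bracket (p.2 + a * p.1 ^ 3) ≤ (1 + |a|) * (1 + ‖p‖) ^ 3 := by
    have e1 : |p.2 + a * p.1 ^ 3| ≤ |p.2| + |a| * |p.1| ^ 3 := by
      refine (abs_add_le _ _).trans (le_of_eq ?_)
      rw [abs_mul, abs_pow]
    have e2 : |p.1| ^ 3 ≤ ‖p‖ ^ 3 := by gcongr
    have e3 : |a| * |p.1| ^ 3 ≤ |a| * ‖p‖ ^ 3 := by gcongr
    have e4 : |a| * ‖p‖ ^ 3 ≤ |a| * (1 + ‖p‖) ^ 3 := by gcongr; linarith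
    have e5 : 1 + ‖p‖ ≤ (1 + ‖p‖) ^ 3 := le_self_pow₀ (by linarith) (by norm_num)
    unfold bracket
    linarith
  have hB : bracket p.1 ≤ 1 + ‖p‖ := by unfold bracket; linarith
  have hx : (1 : ℝ) ≤ 1 + ‖p‖ := by linarith
  have kA : bracket (p.2 + a * p.1 ^ 3) ^ b ≤ (1 + |a|) ^ |b| * (1 + ‖p‖) ^ (3 * |b|) := by
    calc bracket (p.2 + a * p.1 ^ 3) ^ b
        ≤ bracket (p.2 + a * p.1 ^ 3) ^ |b| :=
          Real.rpow_le_rpow_of_exponent_le (one_le_bracket _) (le_abs_self b)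
      _ ≤ ((1 + |a|) * (1 + ‖p‖) ^ 3) ^ |b| :=
          Real.rpow_le_rpow (by linarith [one_le_bracket (p.2 + a * p.1 ^ 3)]) hA (abs_nonneg b)
      _ = (1 + |a|) ^ |b| * (1 + ‖p‖) ^ (3 * |b|) := by
          rw [Real.mul_rpow (by positivity) (by positivity), Real.rpow_mul (by positivity)]
          norm_cast
  have kB : bracket p.1 ^ s ≤ (1 + ‖p‖) ^ |s| :=
    (Real.rpow_le_rpow_of_exponent_le (one_le_bracket _) (le_abs_self s)).trans
      (Real.rpow_le_rpow (by linarith [one_le_bracket p.1]) hB (abs_nonneg s))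
  calc weight a s b p
      ≤ ((1 + |a|) ^ |b| * (1 + ‖p‖) ^ (3 * |b|)) * (1 + ‖p‖) ^ |s| := by
        unfold weight
        refine mul_le_mul kA kB (Real.rpow_nonneg ?_ _) (by positivity)
        linarith [one_le_bracket p.1]
    _ = (1 + |a|) ^ |b| * (1 + ‖p‖) ^ (3 * |b| + |s|) := by
        rw [mul_assoc, Real.rpow_add (by linarith)]
    _ ≤ (1 + |a|) ^ |b| * (1 + ‖p‖) ^ (⌈3 * |b| + |s|⌉₊ : ℝ) := by
        refine mul_le_mul_of_nonneg_left ?_ (by positivity)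
        exact Real.rpow_le_rpow_of_exponent_le hx (Nat.le_ceil _)
    _ = (1 + |a|) ^ |b| * (1 + ‖p‖) ^ ⌈3 * |b| + |s|⌉₊ := by rw [Real.rpow_natCast]

/-- Scaling of the frequency variables by `(2π)⁻¹`, followed by the identification of `ℝ × ℝ`
with the Euclidean plane. -/
def scaleEquiv : (ℝ × ℝ) ≃L[ℝ] WithLp 2 (ℝ × ℝ) :=
  (ContinuousLinearEquiv.smulLeft (Units.mk0 ((2 * Real.pi)⁻¹ : ℝ) (by positivity))).trans
    (WithLp.prodContinuousLinearEquiv 2 ℝ ℝ ℝ).symm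

lemma scaleEquiv_apply (p : ℝ × ℝ) :
    scaleEquiv p = WithLp.toLp 2 ((2 * Real.pi)⁻¹ * p.1, (2 * Real.pi)⁻¹ * p.2) := rfl

/-- The transform `hat` as a linear operator on Schwartz functions, written through Mathlib's
Fourier transform. -/
def hatS : 𝓢(ℝ × ℝ, ℂ) →L[ℂ] 𝓢(ℝ × ℝ, ℂ) :=
  (2 * (Real.pi : ℂ))⁻¹ •
    ((SchwartzMap.compCLMOfContinuousLinearEquiv ℂ scaleEquiv).comp
      ((SchwartzMap.fourierTransformCLM ℂ).comp
        (SchwartzMap.compCLMOfContinuousLinearEquiv ℂ (WithLp.prodContinuousLinearEquiv 2 ℝ ℝ ℝ))))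

lemma hatS_apply (F : 𝓢(ℝ × ℝ, ℂ)) (p : ℝ × ℝ) : hatS F p = hat F p := by
  have hmp : MeasurePreserving (@WithLp.ofLp 2 (ℝ × ℝ)) := WithLp.volume_preserving_ofLp ℝ ℝ
  have hme : MeasurableEmbedding (@WithLp.ofLp 2 (ℝ × ℝ)) :=
    (MeasurableEquiv.toLp 2 (ℝ × ℝ)).symm.measurableEmbedding
  unfold hat
  rw [← hmp.integral_comp hme]
  simp only [hatS, ContinuousLinearMap.comp_apply, smul_eq_mul,
    _root_.smul_apply, SchwartzMap.compCLMOfContinuousLinearEquiv_apply, Function.comp_apply,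
    SchwartzMap.fourierTransformCLM_apply, SchwartzMap.fourier_coe]
  rw [Real.fourier_eq']
  congr 1
  refine integral_congr_ae (Filter.Eventually.of_forall fun q => ?_)
  have hq : inner ℝ q (scaleEquiv p)
      = (2 * Real.pi)⁻¹ * (q.ofLp.1 * p.1 + q.ofLp.2 * p.2) := by
    simp only [scaleEquiv_apply, WithLp.prod_inner_apply, RCLike.inner_apply, conj_trivial]
    ring
  have he : -2 * Real.pi * inner ℝ q (scaleEquiv p) = -(q.ofLp.1 * p.1 + q.ofLp.2 * p.2) := by
    rw [hq]
    have := Real.pi_ne_zero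
    field_simp
  simp only [he, smul_eq_mul, Function.comp_apply,
    WithLp.prodContinuousLinearEquiv_apply]
  congr 2
  push_cast
  ring

lemma memLp_weight_hat (a s b : ℝ) (F : 𝓢(ℝ × ℝ, ℂ)) :
    MemLp (fun p => (weight a s b p : ℂ) * hatS F p) 2 (volume : Measure (ℝ × ℝ)) := by
  obtain ⟨C, n, hC, hw⟩ := exists_weight_le a s b
  have hcont : Continuous fun p => (weight a s b p : ℂ) * hatS F p :=
    (Complex.continuous_ofReal.comp (continuous_weight a s b)).mul (hatS F).continuous
  set D : ℝ := 2 ^ (n + 2) *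
    (Finset.Iic (n + 2, 0)).sup (fun m => SchwartzMap.seminorm ℝ m.1 m.2) (hatS F) with hD
  have hdec (p : ℝ × ℝ) : (1 + ‖p‖) ^ (n + 2) * ‖hatS F p‖ ≤ D := by
    simpa using SchwartzMap.one_add_le_sup_seminorm_apply (𝕜 := ℝ) (m := (n + 2, 0))
      (k := n + 2) (n := 0) le_rfl le_rfl (hatS F) p
  have hbound (p : ℝ × ℝ) :
      ‖(weight a s b p : ℂ) * hatS F p‖ ≤ C * D * (1 + ‖p‖) ^ (-2 : ℝ) := by
    have h1 : (0 : ℝ) < 1 + ‖p‖ := by positivity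
    have h2 : (1 + ‖p‖) ^ (-2 : ℝ) = ((1 + ‖p‖) ^ 2)⁻¹ := by
      rw [Real.rpow_neg h1.le]; norm_cast
    rw [norm_mul, Complex.norm_real, Real.norm_of_nonneg (weight_nonneg a s b p), h2,
      ← div_eq_mul_inv, le_div_iff₀ (by positivity)]
    calc weight a s b p * ‖hatS F p‖ * (1 + ‖p‖) ^ 2
        ≤ C * (1 + ‖p‖) ^ n * ‖hatS F p‖ * (1 + ‖p‖) ^ 2 := by gcongr; exact hw p
      _ = C * ((1 + ‖p‖) ^ (n + 2) * ‖hatS F p‖) := by ring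
      _ ≤ C * D := by gcongr; exact hdec p
  rw [memLp_two_iff_integrable_sq_norm hcont.aestronglyMeasurable]
  have hint : Integrable (fun p : ℝ × ℝ => (C * D) ^ 2 * (1 + ‖p‖) ^ (-4 : ℝ)) :=
    (integrable_one_add_norm (by simp; norm_num)).const_mul _
  refine hint.mono' (hcont.norm.pow 2).aestronglyMeasurable (Filter.Eventually.of_forall fun p => ?_)
  have h1 : (0 : ℝ) ≤ 1 + ‖p‖ := by positivity
  rw [Real.norm_of_nonneg (by positivity)]
  calc ‖(weight a s b p : ℂ) * hatS F p‖ ^ 2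
      ≤ (C * D * (1 + ‖p‖) ^ (-2 : ℝ)) ^ 2 := by gcongr; exact hbound p
    _ = (C * D) ^ 2 * (1 + ‖p‖) ^ (-4 : ℝ) := by
        rw [mul_pow, ← Real.rpow_mul_natCast h1]; norm_num

/-- The weighted transform as an element of `L²`. -/
def toL2 (a s b : ℝ) : 𝓢(ℝ × ℝ, ℂ) →ₗ[ℂ] Lp ℂ 2 (volume : Measure (ℝ × ℝ)) where
  toFun F := (memLp_weight_hat a s b F).toLp _
  map_add' F G := by
    rw [← MemLp.toLp_add]
    congr 1
    ext p
    simp [mul_add]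
  map_smul' c F := by
    rw [RingHom.id_apply, ← MemLp.toLp_const_smul]
    congr 1
    ext p
    simp [mul_left_comm]

lemma norm_toL2 (a s b : ℝ) (F : 𝓢(ℝ × ℝ, ℂ)) : ‖toL2 a s b F‖ = bourgainNorm a s b F := by
  change ‖(memLp_weight_hat a s b F).toLp _‖ = _
  rw [Lp.norm_toLp, (memLp_weight_hat a s b F).eLpNorm_eq_integral_rpow_norm (by norm_num)
    (by norm_num), ENNReal.toReal_ofReal (by positivity), bourgainNorm, Real.sqrt_eq_rpow]
  norm_num
  congr 1
  refine integral_congr_ae (Filter.Eventually.of_forall fun p => ?_)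
  simp only [← weight_sq, ← hatS_apply, mul_pow, sq_abs]

lemma bourgainNorm_zero (a s b : ℝ) : bourgainNorm a s b 0 = 0 := by
  rw [← norm_toL2, map_zero, norm_zero]

lemma bourgainNorm_add_le (a s b : ℝ) (F G : 𝓢(ℝ × ℝ, ℂ)) :
    bourgainNorm a s b (F + G) ≤ bourgainNorm a s b F + bourgainNorm a s b G := by
  simp only [← norm_toL2, map_add]
  exact norm_add_le _ _

lemma bourgainNorm_neg (a s b : ℝ) (F : 𝓢(ℝ × ℝ, ℂ)) :
    bourgainNorm a s b (-F) = bourgainNorm a s b F := by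
  simp only [← norm_toL2, map_neg, norm_neg]

lemma bourgainNorm_smul (a s b : ℝ) (c : ℂ) (F : 𝓢(ℝ × ℝ, ℂ)) :
    bourgainNorm a s b (c • F) = ‖c‖ * bourgainNorm a s b F := by
  simp only [← norm_toL2, map_smul, norm_smul]

/-! ### The spaces -/

/-- The Schwartz space `𝓢(ℝ²)`, to be normed by the Bourgain norm with parameters `a, s, b`. -/
def Core (_a _s _b : ℝ) : Type := 𝓢(ℝ × ℝ, ℂ)

instance (a s b : ℝ) : AddCommGroup (Core a s b) :=
  inferInstanceAs (AddCommGroup 𝓢(ℝ × ℝ, ℂ))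

instance (a s b : ℝ) : Module ℂ (Core a s b) :=
  inferInstanceAs (Module ℂ 𝓢(ℝ × ℝ, ℂ))

/-- The identity map from `𝓢(ℝ²)` to its copy that carries the Bourgain norm. -/
def toCore (a s b : ℝ) : 𝓢(ℝ × ℝ, ℂ) ≃ₗ[ℂ] Core a s b := LinearEquiv.refl ℂ 𝓢(ℝ × ℝ, ℂ)

instance (a s b : ℝ) : SeminormedAddCommGroup (Core a s b) :=
  AddGroupSeminorm.toSeminormedAddCommGroup
    { toFun := fun F => bourgainNorm a s b ((toCore a s b).symm F)
      map_zero' := by rw [map_zero, bourgainNorm_zero]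
      add_le' := fun F G => by rw [map_add]; exact bourgainNorm_add_le a s b _ _
      neg' := fun F => by rw [map_neg, bourgainNorm_neg] }

lemma norm_core (a s b : ℝ) (F : Core a s b) :
    ‖F‖ = bourgainNorm a s b ((toCore a s b).symm F) := rfl

instance (a s b : ℝ) : NormedSpace ℂ (Core a s b) where
  norm_smul_le c F := by rw [norm_core, norm_core, map_smul, bourgainNorm_smul]

/-- The space `X^a_{s,b}`: the completion of `𝓢(ℝ²)` with respect to the Bourgain norm. -/
abbrev X (a s b : ℝ) : Type := UniformSpace.Completion (Core a s b)

/-- The canonical map `𝓢(ℝ²) → X^a_{s,b}`. -/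
def toX (a s b : ℝ) (F : 𝓢(ℝ × ℝ, ℂ)) : X a s b := (toCore a s b F : X a s b)

lemma norm_toX (a s b : ℝ) (F : 𝓢(ℝ × ℝ, ℂ)) : ‖toX a s b F‖ = bourgainNorm a s b F := by
  rw [toX, UniformSpace.Completion.norm_coe, norm_core, LinearEquiv.symm_apply_apply]

/-- `(uv)_x` for Schwartz functions `u, v` of `(x, t)`. -/
def dxMul (u v : 𝓢(ℝ × ℝ, ℂ)) : 𝓢(ℝ × ℝ, ℂ) :=
  ∂_{((1 : ℝ), (0 : ℝ))} (SchwartzMap.pairing (ContinuousLinearMap.mul ℂ ℂ) u v)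

/-- The estimate `‖(uv)_x‖_{X^a_{s,b'}} ≤ c ‖u‖_{X^{a₁}_{s,b}} ‖v‖_{X^{a₂}_{s,b}}` for all
`u ∈ X^{a₁}_{s,b}` and `v ∈ X^{a₂}_{s,b}`. As these spaces are completions of `𝓢(ℝ²)`, the
expression `(uv)_x` stands for the value at `(u, v)` of the continuous bilinear map `B` which is
`(u, v) ↦ (uv)_x` on Schwartz functions (at most one such `B` exists, by density). -/
def DxMulEstimate (a₁ a₂ a s b b' c : ℝ) : Prop :=
  ∃ B : X a₁ s b →L[ℂ] X a₂ s b →L[ℂ] X a s b',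
    (∀ u v : 𝓢(ℝ × ℝ, ℂ), B (toX a₁ s b u) (toX a₂ s b v) = toX a s b' (dxMul u v)) ∧
    ∀ (u : X a₁ s b) (v : X a₂ s b), ‖B u v‖ ≤ c * ‖u‖ * ‖v‖

end Bourgain

end

open scoped ENNReal

noncomputable section

namespace Bourgain

/-! ### Passage to the completions -/

/-! On the Fourier side each estimate bounds a trilinear form over triples of space-time frequencies
with sum zero, weighted by `symbol`. The output is reflected to `-(p + q)`, and each member `(ξ, τ)`
of the triple carries a modulation `τ + α ξ³` with `α = ±1`. In all four estimates exactly one of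
the three signs differs from the other two; its frequency is called odd.

If `x` is the odd frequency and `y, z` are the others, the modulations add up to `±(x³ - y³ - z³)`.
Since `x + y + z = 0`, this has size at least a constant times `|x| (|y| + |z|)²` (`resonance_le`).
Hence the largest modulation is at least a third of that, and its weight pays for the derivative and
for the negative regularity (`mul_modulation_le`). There remains a `pairKernel`, which involves only
the other two modulations.

Freezing the frequency whose modulation was spent, Cauchy-Schwarz (`lintegral_trilinear_le`) asks
only for a uniform bound on the integral of `pairKernel` over the other variable
(`exists_lintegral_pairKernel_le`). The `τ` integral converges because `2b > 1`. In the `ξ`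
integral, `gain` is comparable to the derivative of the cubic phase, up to a part of bounded
contribution, so a change of variables finishes.

For opposite signs the derivative is `3(x² + y²)`. For equal signs it is a multiple of `|x + y| |x -
y|`, and at equal frequencies only `√|x + y|` of the gain survives. This is the critical case. At
frequency size `N` and regularity `-ρ` the squared multiplier `N^(2 + 2ρ)`, divided by `N^(3g)` from
the resonance with `g = -2b'`, must be at most `N^(1/2)`. So `g = 1/2 + 2ρ/3` (`modExp`), and `g <
1` exactly when `ρ < 3/4`. -/

lemma dxMul_add_left (u u' v : 𝓢(ℝ × ℝ, ℂ)) : dxMul (u + u') v = dxMul u v + dxMul u' v := by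
  simp only [dxMul, map_add, _root_.add_apply, LineDeriv.lineDerivOp_add]

lemma dxMul_smul_left (c : ℂ) (u v : 𝓢(ℝ × ℝ, ℂ)) : dxMul (c • u) v = c • dxMul u v := by
  simp only [dxMul, map_smul, _root_.smul_apply, LineDeriv.lineDerivOp_smul]

lemma dxMul_comm (u v : 𝓢(ℝ × ℝ, ℂ)) : dxMul u v = dxMul v u := by
  unfold dxMul
  congr 1
  ext p
  simp [mul_comm]

lemma dxMul_add_right (u v v' : 𝓢(ℝ × ℝ, ℂ)) : dxMul u (v + v') = dxMul u v + dxMul u v' := by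
  simp only [dxMul_comm u, dxMul_add_left]

lemma dxMul_smul_right (c : ℂ) (u v : 𝓢(ℝ × ℝ, ℂ)) : dxMul u (c • v) = c • dxMul u v := by
  simp only [dxMul_comm u, dxMul_smul_left]

/-- `(u, v) ↦ (uv)_x` as a bilinear map from Schwartz functions to `X^a_{s,b'}`. -/
def dxMulLin (a₁ b₁ a₂ b₂ a s b' : ℝ) : Core a₁ s b₁ →ₗ[ℂ] Core a₂ s b₂ →ₗ[ℂ] X a s b' :=
  LinearMap.mk₂ ℂ
    (fun u v => UniformSpace.Completion.toComplL (𝕜 := ℂ) (toCore a s b'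
      (dxMul ((toCore a₁ s b₁).symm u) ((toCore a₂ s b₂).symm v))))
    (fun _ _ _ => by simp only [map_add, dxMul_add_left])
    (fun _ _ _ => by simp only [map_smul, dxMul_smul_left])
    (fun _ _ _ => by simp only [map_add, dxMul_add_right])
    (fun _ _ _ => by simp only [map_smul, dxMul_smul_right])

/-- A bounded bilinear map on dense subspaces extends one variable at a time, and the inequality
persists because it is a closed condition. -/
lemma dxMulEstimate_of_schwartz {a₁ a₂ a s b b' c : ℝ}
    (h : ∀ u v : 𝓢(ℝ × ℝ, ℂ),
      bourgainNorm a s b' (dxMul u v) ≤ c * bourgainNorm a₁ s b u * bourgainNorm a₂ s b v) :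
    DxMulEstimate a₁ a₂ a s b b' c := by
  let B₀ : Core a₁ s b →L[ℂ] Core a₂ s b →L[ℂ] X a s b' :=
    (dxMulLin a₁ b a₂ b a s b').mkContinuous₂ c fun u v => by
      change ‖toX a s b' _‖ ≤ _
      rw [norm_toX, norm_core, norm_core]
      exact h _ _
  let e₁ : Core a₁ s b →L[ℂ] X a₁ s b := UniformSpace.Completion.toComplL
  let e₂ : Core a₂ s b →L[ℂ] X a₂ s b := UniformSpace.Completion.toComplL
  have d₁ : DenseRange e₁ := UniformSpace.Completion.denseRange_coe
  have d₂ : DenseRange e₂ := UniformSpace.Completion.denseRange_coe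
  have i₁ : IsUniformInducing e₁ := UniformSpace.Completion.isUniformInducing_coe _
  have i₂ : IsUniformInducing e₂ := UniformSpace.Completion.isUniformInducing_coe _
  let B : X a₁ s b →L[ℂ] X a₂ s b →L[ℂ] X a s b' := ((B₀.extend e₁).flip.extend e₂).flip
  have hB (u : Core a₁ s b) (v : Core a₂ s b) : B (e₁ u) (e₂ v) = B₀ u v := by
    change ((B₀.extend e₁).flip.extend e₂) (e₂ v) (e₁ u) = _
    rw [ContinuousLinearMap.extend_eq _ d₂ i₂, ContinuousLinearMap.flip_apply,
      ContinuousLinearMap.extend_eq _ d₁ i₁]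
  refine ⟨B, fun u v => hB _ _, fun u v => ?_⟩
  induction u, v using UniformSpace.Completion.induction_on₂ with
  | hp => exact isClosed_le (by fun_prop) (by fun_prop)
  | ih u v =>
    rw [UniformSpace.Completion.norm_coe, UniformSpace.Completion.norm_coe]
    change ‖B (e₁ u) (e₂ v)‖ ≤ _
    rw [hB]
    change ‖toX a s b' _‖ ≤ _
    rw [norm_toX, norm_core, norm_core]
    exact h _ _

lemma DxMulEstimate.symm {a₁ a₂ a s b b' c : ℝ} (h : DxMulEstimate a₁ a₂ a s b b' c) :
    DxMulEstimate a₂ a₁ a s b b' c := by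
  obtain ⟨B, h1, h2⟩ := h
  refine ⟨B.flip, fun u v => ?_, fun u v => ?_⟩
  · rw [ContinuousLinearMap.flip_apply, h1, dxMul_comm]
  · rw [ContinuousLinearMap.flip_apply, mul_right_comm]
    exact h2 v u

/-! ### The Fourier transform of the nonlinearity -/

open Real in
-- Convolution of Schwartz functions is multiplication conjugated by the Fourier transform. Applied
-- to the inverse transforms and evaluated at `-x`, it gives the forward transform of a product.
lemma fourier_pairing {V : Type*} [NormedAddCommGroup V] [InnerProductSpace ℝ V]
    [FiniteDimensional ℝ V] [MeasurableSpace V] [BorelSpace V] (f g : 𝓢(V, ℂ)) (x : V) :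
    𝓕 (SchwartzMap.pairing (ContinuousLinearMap.mul ℂ ℂ) f g) x =
      ∫ y, 𝓕 f y * 𝓕 g (x - y) := by
  have h1 := SchwartzMap.convolution_apply (ContinuousLinearMap.mul ℂ ℂ) (𝓕⁻ f) (𝓕⁻ g) (-x)
  have h2 : SchwartzMap.convolution (ContinuousLinearMap.mul ℂ ℂ) (𝓕⁻ f) (𝓕⁻ g) =
      𝓕⁻ (SchwartzMap.pairing (ContinuousLinearMap.mul ℂ ℂ) f g) := by
    simp [SchwartzMap.convolution]
  have h3 (f : 𝓢(V, ℂ)) (y : V) : (𝓕⁻ f) (-y) = 𝓕 f y := by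
    rw [SchwartzMap.fourierInv_coe, SchwartzMap.fourier_coe, Real.fourierInv_eq_fourier_neg, neg_neg]
  rw [h2, h3] at h1
  rw [h1, convolution, ← integral_neg_eq_self]
  refine integral_congr_ae (.of_forall fun y => ?_)
  simp only [ContinuousLinearMap.mul_apply']
  rw [h3, ← h3 g]
  congr 2
  abel


lemma hatS_eq_fourier (F : 𝓢(ℝ × ℝ, ℂ)) (p : ℝ × ℝ) :
    hatS F p = (2 * (Real.pi : ℂ))⁻¹ * 𝓕 (SchwartzMap.compCLMOfContinuousLinearEquiv ℂ
      (WithLp.prodContinuousLinearEquiv 2 ℝ ℝ ℝ) F) (scaleEquiv p) := rfl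

open Real in
lemma hatS_dxMul (u v : 𝓢(ℝ × ℝ, ℂ)) (p : ℝ × ℝ) :
    hatS (dxMul u v) p =
      (2 * (π : ℂ))⁻¹ * Complex.I * p.1 * ∫ q, hatS u q * hatS v (p - q) := by
  set T := SchwartzMap.compCLMOfContinuousLinearEquiv ℂ (F := ℂ)
    (WithLp.prodContinuousLinearEquiv 2 ℝ ℝ ℝ) with hT
  have h1 : T (dxMul u v) = ∂_{WithLp.toLp 2 ((1 : ℝ), (0 : ℝ))}
      (SchwartzMap.pairing (ContinuousLinearMap.mul ℂ ℂ) (T u) (T v)) := by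
    have : SchwartzMap.pairing (ContinuousLinearMap.mul ℂ ℂ) (T u) (T v) =
      T (SchwartzMap.pairing (ContinuousLinearMap.mul ℂ ℂ) u v) := by ext; rfl
    rw [this, hT, SchwartzMap.lineDerivOp_compCLMOfContinuousLinearEquiv]
    rfl
  have htg : (inner ℝ · (WithLp.toLp 2 ((1 : ℝ), (0 : ℝ)))).HasTemperateGrowth :=
    ((innerSL ℝ).flip _).hasTemperateGrowth
  have hpi : (π : ℂ) ≠ 0 := by exact_mod_cast pi_ne_zero
  rw [hatS_eq_fourier, h1, SchwartzMap.fourier_lineDerivOp_eq]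
  simp only [_root_.smul_apply, SchwartzMap.smulLeftCLM_apply_apply htg]
  rw [fourier_pairing]
  have hmp : MeasurePreserving (@WithLp.toLp 2 (ℝ × ℝ)) := WithLp.volume_preserving_toLp ℝ ℝ
  have hme : MeasurableEmbedding (@WithLp.toLp 2 (ℝ × ℝ)) :=
    (MeasurableEquiv.toLp 2 (ℝ × ℝ)).measurableEmbedding
  rw [← hmp.integral_comp hme]
  -- `hat` lives on frequencies scaled by `2π`; in dimension two the substitution costs `(2π)²`.
  have h2 := Measure.integral_comp_smul (volume : Measure (ℝ × ℝ))
    (fun z => 𝓕 (T u) (WithLp.toLp 2 z) * 𝓕 (T v) (scaleEquiv p - WithLp.toLp 2 z)) (2 * π)⁻¹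
  have h3 : ∀ q : ℝ × ℝ, 𝓕 (T u) (WithLp.toLp 2 ((2 * π)⁻¹ • q)) *
      𝓕 (T v) (scaleEquiv p - WithLp.toLp 2 ((2 * π)⁻¹ • q)) =
      (2 * π : ℂ) ^ 2 * (hatS u q * hatS v (p - q)) := by
    intro q
    have : scaleEquiv p - WithLp.toLp 2 ((2 * π)⁻¹ • q) = scaleEquiv (p - q) := by
      rw [map_sub]; rfl
    rw [this, hatS_eq_fourier, hatS_eq_fourier]
    have : WithLp.toLp 2 ((2 * π)⁻¹ • q) = scaleEquiv q := rfl
    rw [this]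
    field_simp
    rfl
  simp only [h3] at h2
  rw [integral_const_mul] at h2
  have h4 : |(((2 * π)⁻¹ ^ Module.finrank ℝ (ℝ × ℝ))⁻¹ : ℝ)| = (2 * π) ^ 2 := by
    rw [abs_of_nonneg (by positivity), inv_pow, inv_inv]
    simp
  rw [h4] at h2
  have h5 : inner ℝ (scaleEquiv p) (WithLp.toLp 2 ((1 : ℝ), (0 : ℝ))) = (2 * π)⁻¹ * p.1 := by
    simp [scaleEquiv_apply, WithLp.prod_inner_apply]
  have h6 := mul_left_cancel₀ (a := ((2 * π : ℂ) ^ 2)) (by simp [hpi])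
    (h2.trans (by rw [Complex.real_smul]; push_cast; rfl))
  rw [h5, ← h6]
  simp only [smul_eq_mul, Complex.real_smul]
  push_cast
  field_simp

/-! ### Integrals of powers of the bracket -/

lemma bracket_pos (x : ℝ) : 0 < bracket x := by linarith [one_le_bracket x]

lemma continuous_bracket : Continuous bracket := by unfold bracket; fun_prop

lemma bracket_neg (x : ℝ) : bracket (-x) = bracket x := by simp [bracket]

/-- The power `⟨x⟩^{-r}` with values in `[0, ∞]`. -/
def decay (r x : ℝ) : ℝ≥0∞ := ENNReal.ofReal (bracket x ^ (-r))

lemma measurable_decay (r : ℝ) : Measurable (decay r) :=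
  ENNReal.measurable_ofReal.comp
    (continuous_bracket.rpow_const fun x => Or.inl (bracket_pos x).ne').measurable

lemma decay_le_one {r : ℝ} (hr : 0 ≤ r) (x : ℝ) : decay r x ≤ 1 := by
  rw [decay, ← ENNReal.ofReal_one]
  exact ENNReal.ofReal_le_ofReal
    (Real.rpow_le_one_of_one_le_of_nonpos (one_le_bracket x) (by linarith))

lemma lintegral_decay_ne_top {r : ℝ} (hr : 1 < r) : ∫⁻ x, decay r x ≠ ∞ := by
  have h : Integrable (fun x : ℝ => (1 + ‖x‖) ^ (-r)) := integrable_one_add_norm (by simpa using hr)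
  exact h.lintegral_lt_top.ne

/-- The larger of `|x|, |y|` is at least `|x + y| / 2`, so its factor alone supplies the decay in `x
+ y`, at the cost of `2 ^ r`. Integrated, this shows that convolving `⟨·⟩^{-r}` with itself does not
spoil the decay. -/
lemma decay_mul_decay_le {r : ℝ} (hr : 0 ≤ r) (x y : ℝ) :
    decay r x * decay r y ≤ ENNReal.ofReal (2 ^ r) * decay r (x + y) * (decay r x + decay r y) := by
  have key (x y : ℝ) (h : |x| ≤ |y|) : decay r y ≤ ENNReal.ofReal (2 ^ r) * decay r (x + y) := by
    unfold decay
    rw [← ENNReal.ofReal_mul (by positivity)]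
    refine ENNReal.ofReal_le_ofReal ?_
    have h1 : bracket (x + y) / 2 ≤ bracket y := by
      unfold bracket; linarith [abs_add_le x y, abs_nonneg y]
    calc bracket y ^ (-r) ≤ (bracket (x + y) / 2) ^ (-r) :=
          Real.rpow_le_rpow_of_nonpos (by linarith [bracket_pos (x + y)]) h1 (by linarith)
      _ = 2 ^ r * bracket (x + y) ^ (-r) := by
          rw [Real.div_rpow (bracket_pos _).le (by norm_num), Real.rpow_neg (x := 2) (by norm_num)]
          field_simp
  rcases le_total |x| |y| with h | h
  · calc decay r x * decay r y ≤ decay r x * (ENNReal.ofReal (2 ^ r) * decay r (x + y)) := by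
          gcongr; exact key x y h
      _ ≤ (decay r x + decay r y) * (ENNReal.ofReal (2 ^ r) * decay r (x + y)) := by
          gcongr; exact le_self_add
      _ = _ := by ring
  · calc decay r x * decay r y ≤ (ENNReal.ofReal (2 ^ r) * decay r (x + y)) * decay r y := by
          gcongr; rw [add_comm]; exact key y x h
      _ ≤ (ENNReal.ofReal (2 ^ r) * decay r (x + y)) * (decay r x + decay r y) := by
          gcongr; exact le_add_self
      _ = _ := by ring

lemma lintegral_decay_mul_decay_le {r : ℝ} (hr : 0 ≤ r) (c d : ℝ) :
    ∫⁻ t, decay r (t + c) * decay r (d - t) ≤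
      (2 * ENNReal.ofReal (2 ^ r) * ∫⁻ x, decay r x) * decay r (c + d) := by
  have hm := measurable_decay r
  calc ∫⁻ t, decay r (t + c) * decay r (d - t)
      ≤ ∫⁻ t, ENNReal.ofReal (2 ^ r) * decay r (c + d) * (decay r (t + c) + decay r (d - t)) := by
        refine lintegral_mono fun t => ?_
        have := decay_mul_decay_le hr (t + c) (d - t)
        rwa [show t + c + (d - t) = c + d by ring] at this
    _ = ENNReal.ofReal (2 ^ r) * decay r (c + d) * ((∫⁻ x, decay r x) + ∫⁻ x, decay r x) := by
        rw [lintegral_const_mul _ (by fun_prop), lintegral_add_left (by fun_prop),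
          lintegral_add_right_eq_self (decay r) c, lintegral_sub_left_eq_self (decay r) d]
    _ = _ := by ring

/-! ### Change of variables along the cubic phase. -/

lemma setLIntegral_deriv_mul_decay_le {r : ℝ} {f f' : ℝ → ℝ} {S : Set ℝ} (hS : MeasurableSet S)
    (hf : ∀ x, HasDerivAt f (f' x) x) (hi : Set.InjOn f S) :
    ∫⁻ x in S, ENNReal.ofReal |f' x| * decay r (f x) ≤ ∫⁻ x, decay r x := by
  rw [← lintegral_image_eq_lintegral_abs_deriv_mul hS (fun x _ => (hf x).hasDerivWithinAt) hi]
  exact setLIntegral_le_lintegral _ _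

/-- The phase is strictly monotone with derivative `3(x² + (z + x)²)` up to sign. Outside `[-1, 1]`
the weight is at most twice this Jacobian; inside, the excess is at most `2` on a set of length `2`,
whence the `4`. -/
lemma lintegral_mul_decay_le_of_opposite {r : ℝ} (hr : 0 ≤ r) {a : ℝ} (ha : |a| = 1) (c z : ℝ) :
    ∫⁻ x, ENNReal.ofReal (1 + x ^ 2 + (z + x) ^ 2) * decay r (c + a * (x ^ 3 + (z + x) ^ 3)) ≤
      4 + 2 * ∫⁻ x, decay r x := by
  have hm := measurable_decay r
  have ha0 : a ≠ 0 := by rintro rfl; simp at ha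
  have hd (x : ℝ) : HasDerivAt (fun x : ℝ => c + a * (x ^ 3 + (z + x) ^ 3))
      (a * (3 * x ^ 2 + 3 * (z + x) ^ 2)) x := by
    have h2 : HasDerivAt (fun x : ℝ => z + x) 1 x := (hasDerivAt_id x).const_add z
    refine ((((hasDerivAt_id x).pow 3).add (h2.pow 3)).const_mul a).const_add c |>.congr_deriv ?_
    simp
  have hinj : Set.InjOn (fun x : ℝ => c + a * (x ^ 3 + (z + x) ^ 3)) Set.univ := by
    intro x _ y _ h
    have h1 : x ^ 3 + (z + x) ^ 3 = y ^ 3 + (z + y) ^ 3 := mul_left_cancel₀ ha0 (add_left_cancel h)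
    have hmono : StrictMono fun x : ℝ => x ^ 3 + (z + x) ^ 3 :=
      ((Odd.strictMono_pow (by decide : Odd 3))).add
        ((Odd.strictMono_pow (by decide : Odd 3)).comp (fun _ _ h => by simpa using h))
    exact hmono.injective h1
  have hmain := setLIntegral_deriv_mul_decay_le (r := r) MeasurableSet.univ hd hinj
  rw [setLIntegral_univ] at hmain
  calc ∫⁻ x, ENNReal.ofReal (1 + x ^ 2 + (z + x) ^ 2) * decay r (c + a * (x ^ 3 + (z + x) ^ 3))
      ≤ ∫⁻ x, ((Set.Icc (-1 : ℝ) 1).indicator (fun _ => 2) x +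
          2 * (ENNReal.ofReal |a * (3 * x ^ 2 + 3 * (z + x) ^ 2)| *
            decay r (c + a * (x ^ 3 + (z + x) ^ 3)))) := by
        refine lintegral_mono fun x => ?_
        have e1 : |a * (3 * x ^ 2 + 3 * (z + x) ^ 2)| = 3 * x ^ 2 + 3 * (z + x) ^ 2 := by
          rw [abs_mul, ha, one_mul, abs_of_nonneg (by positivity)]
        simp only [e1]
        by_cases hx : x ∈ Set.Icc (-1 : ℝ) 1
        · rw [Set.indicator_of_mem hx]
          have hx2 : x ^ 2 ≤ 1 := by nlinarith [hx.1, hx.2]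
          have : ENNReal.ofReal (1 + x ^ 2 + (z + x) ^ 2) ≤
              2 + 2 * ENNReal.ofReal (3 * x ^ 2 + 3 * (z + x) ^ 2) := by
            rw [show (2 : ℝ≥0∞) = ENNReal.ofReal 2 by simp, ← ENNReal.ofReal_mul (by norm_num),
              ← ENNReal.ofReal_add (by norm_num) (by positivity)]
            exact ENNReal.ofReal_le_ofReal (by nlinarith [sq_nonneg (z + x)])
          refine (mul_le_mul_left this _).trans ?_
          rw [add_mul, mul_assoc]
          gcongr
          exact mul_le_of_le_one_right' (decay_le_one hr _)
        · rw [Set.indicator_of_notMem hx, zero_add, ← mul_assoc]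
          gcongr
          have hx2 : 1 ≤ x ^ 2 := by
            by_contra! h
            exact hx ⟨by nlinarith, by nlinarith⟩
          rw [show (2 : ℝ≥0∞) = ENNReal.ofReal 2 by simp, ← ENNReal.ofReal_mul (by norm_num)]
          exact ENNReal.ofReal_le_ofReal (by nlinarith [sq_nonneg (z + x)])
    _ ≤ _ := by
        rw [lintegral_add_left (measurable_const.indicator measurableSet_Icc),
          lintegral_const_mul _ (by fun_prop), lintegral_indicator_const measurableSet_Icc]
        gcongr
        rw [Real.volume_Icc]
        norm_num

/-- The phase is quadratic in `x` with vertex at `-z / 2`, hence injective on each half-line, and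
its Jacobian is `3 |z| |2x + z|`. The extra `√|z|` is dominated by the Jacobian except where `|2x +
z| ≤ |z|^(-1/2)`, an interval of length `|z|^(-1/2)` on which it integrates to `1`. -/
lemma lintegral_mul_decay_le_of_same {r : ℝ} (hr : 0 ≤ r) {a : ℝ} (ha : |a| = 1) (c z : ℝ) :
    ∫⁻ x, ENNReal.ofReal (√|z| + |z| * |2 * x + z|) * decay r (c + a * (x ^ 3 - (z + x) ^ 3)) ≤
      2 + 4 * ∫⁻ x, decay r x := by
  have hm := measurable_decay r
  have ha0 : a ≠ 0 := by rintro rfl; simp at ha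
  rcases eq_or_ne z 0 with rfl | hz
  · simp
  have hz' : 0 < |z| := abs_pos.2 hz
  set f : ℝ → ℝ := fun x => c + a * (x ^ 3 - (z + x) ^ 3) with hfdef
  set f' : ℝ → ℝ := fun x => -(3 * a * z * (2 * x + z)) with hf'def
  have hd (x : ℝ) : HasDerivAt f (f' x) x := by
    have h2 : HasDerivAt (fun x : ℝ => z + x) 1 x := (hasDerivAt_id x).const_add z
    refine ((((hasDerivAt_id x).pow 3).sub (h2.pow 3)).const_mul a).const_add c |>.congr_deriv ?_
    simp [hf'def]
    ring
  have hfeq (x y : ℝ) (h : f x = f y) : (x - y) * (x + y + z) = 0 := by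
    have h1 : x ^ 3 - (z + x) ^ 3 = y ^ 3 - (z + y) ^ 3 := mul_left_cancel₀ ha0 (add_left_cancel h)
    have h2 : (-3 * z) * ((x - y) * (x + y + z)) = 0 := by linear_combination h1
    exact (mul_eq_zero.1 h2).resolve_left (by simpa using hz)
  have hi1 : Set.InjOn f (Set.Ioi (-z / 2)) := by
    intro x hx y hy h
    have hx' : -z / 2 < x := hx
    have hy' : -z / 2 < y := hy
    rcases mul_eq_zero.1 (hfeq x y h) with h | h <;> linarith
  have hi2 : Set.InjOn f (Set.Iic (-z / 2)) := by
    intro x hx y hy h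
    have hx' : x ≤ -z / 2 := hx
    have hy' : y ≤ -z / 2 := hy
    rcases mul_eq_zero.1 (hfeq x y h) with h | h <;> linarith
  have hmain : ∫⁻ x, ENNReal.ofReal |f' x| * decay r (f x) ≤ 2 * ∫⁻ x, decay r x := by
    rw [← lintegral_add_compl _ (measurableSet_Iic (a := -z / 2)), Set.compl_Iic, two_mul]
    exact add_le_add (setLIntegral_deriv_mul_decay_le measurableSet_Iic hd hi2)
      (setLIntegral_deriv_mul_decay_le measurableSet_Ioi hd hi1)
  have hf'abs (x : ℝ) : |f' x| = 3 * (|z| * |2 * x + z|) := by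
    simp only [hf'def, abs_neg, abs_mul, ha]
    norm_num [mul_assoc]
  set S : Set ℝ := Set.Icc ((-z - (√|z|)⁻¹) / 2) ((-z + (√|z|)⁻¹) / 2) with hS
  have hs : 0 < √|z| := Real.sqrt_pos.2 hz'
  calc ∫⁻ x, ENNReal.ofReal (√|z| + |z| * |2 * x + z|) * decay r (f x)
      ≤ ∫⁻ x, (S.indicator (fun _ => ENNReal.ofReal √|z|) x +
          2 * (ENNReal.ofReal |f' x| * decay r (f x))) := by
        refine lintegral_mono fun x => ?_
        simp only [hf'abs]
        by_cases hx : x ∈ S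
        · rw [Set.indicator_of_mem hx, ENNReal.ofReal_add (by positivity) (by positivity), add_mul]
          refine add_le_add (mul_le_of_le_one_right' (decay_le_one hr _)) ?_
          rw [← mul_assoc]
          gcongr
          rw [show (2 : ℝ≥0∞) = ENNReal.ofReal 2 by simp, ← ENNReal.ofReal_mul (by norm_num)]
          exact ENNReal.ofReal_le_ofReal (by nlinarith [mul_nonneg (abs_nonneg z) (abs_nonneg (2 * x + z))])
        · rw [Set.indicator_of_notMem hx, zero_add, ← mul_assoc]
          gcongr
          have h1 : (√|z|)⁻¹ ≤ |2 * x + z| := by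
            by_contra! h
            rw [abs_lt] at h
            exact hx ⟨by linarith, by linarith⟩
          have h2 : √|z| ≤ |z| * |2 * x + z| := by
            calc √|z| = |z| * (√|z|)⁻¹ := by
                  rw [eq_mul_inv_iff_mul_eq₀ hs.ne', Real.mul_self_sqrt hz'.le]
              _ ≤ _ := by gcongr
          rw [show (2 : ℝ≥0∞) = ENNReal.ofReal 2 by simp, ← ENNReal.ofReal_mul (by norm_num)]
          exact ENNReal.ofReal_le_ofReal (by linarith)
    _ ≤ _ := by
        have hmf' : Measurable f' := by fun_prop
        have hmf : Measurable f := by fun_prop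
        rw [lintegral_add_left (measurable_const.indicator measurableSet_Icc),
          lintegral_const_mul _ (by fun_prop), lintegral_indicator_const measurableSet_Icc,
          Real.volume_Icc, ← ENNReal.ofReal_mul (by positivity)]
        refine add_le_add ?_ ?_
        · rw [show (2 : ℝ≥0∞) = ENNReal.ofReal 2 by simp]
          refine ENNReal.ofReal_le_ofReal ?_
          rw [show (-z + (√|z|)⁻¹) / 2 - (-z - (√|z|)⁻¹) / 2 = (√|z|)⁻¹ by ring,
            mul_inv_cancel₀ hs.ne']
          norm_num
        · calc _ ≤ 2 * (2 * ∫⁻ x, decay r x) := by gcongr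
            _ = _ := by ring

/-- Integration of the kernel in the modulation variable. -/
lemma lintegral_prod_decay_le {r : ℝ} (hr : 0 ≤ r) {Q : ℝ → ℝ≥0∞} (hQ : Measurable Q)
    {a a' z : ℝ} {C : ℝ≥0∞}
    (h : ∀ c, ∫⁻ x, Q x * decay r (c + a * x ^ 3 + a' * (-z - x) ^ 3) ≤ C) (t : ℝ) :
    ∫⁻ p : ℝ × ℝ, Q p.1 * decay r (p.2 + a * p.1 ^ 3) *
      decay r (-t - p.2 + a' * (-z - p.1) ^ 3) ≤
      (2 * ENNReal.ofReal (2 ^ r) * ∫⁻ x, decay r x) * C := by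
  have hm := measurable_decay r
  rw [Measure.volume_eq_prod, lintegral_prod _ (by fun_prop)]
  calc ∫⁻ x, ∫⁻ y, Q x * decay r (y + a * x ^ 3) * decay r (-t - y + a' * (-z - x) ^ 3)
      ≤ ∫⁻ x, (2 * ENNReal.ofReal (2 ^ r) * ∫⁻ x, decay r x) *
          (Q x * decay r (-t + a * x ^ 3 + a' * (-z - x) ^ 3)) := by
        refine lintegral_mono fun x => ?_
        have := lintegral_decay_mul_decay_le hr (a * x ^ 3) (-t + a' * (-z - x) ^ 3)
        simp only [mul_assoc (Q x)]
        rw [lintegral_const_mul _ (by fun_prop)]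
        calc Q x * ∫⁻ y, decay r (y + a * x ^ 3) * decay r (-t - y + a' * (-z - x) ^ 3)
            = Q x * ∫⁻ y, decay r (y + a * x ^ 3) * decay r (-t + a' * (-z - x) ^ 3 - y) := by
              congr 2; ext y; congr 2; ring
          _ ≤ _ := by
              refine (mul_le_mul_right this _).trans (le_of_eq ?_)
              rw [show a * x ^ 3 + (-t + a' * (-z - x) ^ 3) = -t + a * x ^ 3 + a' * (-z - x) ^ 3 by
                ring]
              ring
    _ ≤ _ := by
        rw [lintegral_const_mul _ (by fun_prop)]
        gcongr
        exact h (-t)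

/-! ### Pointwise bounds for the multiplier -/

lemma rpow_neg_le_of_mul_sq_le {x n w g : ℝ} (hx : 0 < x) (hn : 0 < n) (hg0 : 0 ≤ g) (hg1 : g ≤ 1)
    (hw : x * n ^ 2 / 4 ≤ w) : w ^ (-g) ≤ 4 * x ^ (-g) * n ^ (-(2 * g)) := by
  calc w ^ (-g) ≤ (x * n ^ 2 / 4) ^ (-g) :=
        Real.rpow_le_rpow_of_nonpos (by positivity) hw (by linarith)
    _ = 4 ^ g * x ^ (-g) * n ^ (-(2 * g)) := by
        rw [Real.div_rpow (by positivity) (by norm_num), Real.mul_rpow hx.le (by positivity),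
          ← Real.rpow_natCast n 2, ← Real.rpow_mul hn.le, Real.rpow_neg (x := 4) (by norm_num),
          div_inv_eq_mul]
        push_cast
        rw [show (2 : ℝ) * -g = -(2 * g) by ring]
        ring
    _ ≤ 4 * x ^ (-g) * n ^ (-(2 * g)) := by
        gcongr
        calc (4 : ℝ) ^ g ≤ 4 ^ (1 : ℝ) := Real.rpow_le_rpow_of_exponent_le (by norm_num) hg1
          _ = 4 := Real.rpow_one 4

lemma one_add_rpow_le {n e : ℝ} (hn : 1 ≤ n) (he0 : 0 ≤ e) {k : ℕ} (he : e ≤ k) :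
    (1 + n) ^ e ≤ 2 ^ k * n ^ e := by
  calc (1 + n) ^ e ≤ (2 * n) ^ e := Real.rpow_le_rpow (by linarith) (by linarith) he0
    _ = 2 ^ e * n ^ e := Real.mul_rpow (by norm_num) (by linarith)
    _ ≤ 2 ^ k * n ^ e := by
        gcongr
        rw [← Real.rpow_natCast]
        exact Real.rpow_le_rpow_of_exponent_le (by norm_num) he

/-- The exponent `-2b'` which is used for the regularity `-ρ`. -/
def modExp (ρ : ℝ) : ℝ := 1 / 2 + 2 / 3 * ρ

section
variable {ρ x n y w : ℝ}

lemma outer_aux (h1 : 5 / 8 ≤ ρ) (h2 : ρ < 3 / 4) (hx : 0 < x) (hn : 1 ≤ n)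
    (hw : x * n ^ 2 / 4 ≤ w) :
    x ^ 2 * (1 + x) ^ (-(2 * ρ)) * (1 + n) ^ (4 * ρ) * w ^ (-modExp ρ) ≤
      32 * (x ^ (2 - modExp ρ) * (1 + x) ^ (-(2 * ρ)) * n ^ (4 * ρ - 2 * modExp ρ)) := by
  have hg0 : 0 ≤ modExp ρ := by unfold modExp; linarith
  have hg1 : modExp ρ ≤ 1 := by unfold modExp; linarith
  have hn0 : 0 < n := by linarith
  have e1 := rpow_neg_le_of_mul_sq_le hx hn0 hg0 hg1 hw
  have e2 := one_add_rpow_le hn (e := 4 * ρ) (by linarith) (k := 3) (by norm_num; linarith)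
  calc x ^ 2 * (1 + x) ^ (-(2 * ρ)) * (1 + n) ^ (4 * ρ) * w ^ (-modExp ρ)
      ≤ x ^ 2 * (1 + x) ^ (-(2 * ρ)) * (2 ^ 3 * n ^ (4 * ρ)) *
        (4 * x ^ (-modExp ρ) * n ^ (-(2 * modExp ρ))) := by
        have : 0 ≤ w ^ (-modExp ρ) := Real.rpow_nonneg (le_trans (by positivity) hw) _
        gcongr
    _ = _ := by
        rw [sub_eq_add_neg, sub_eq_add_neg, Real.rpow_add hx, Real.rpow_add hn0, Real.rpow_two]
        ring

/-- For low frequencies the resonance is not used: every factor but `x ^ 2` is bounded. -/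
lemma outer_small (h1 : 5 / 8 ≤ ρ) (h2 : ρ < 3 / 4) (hx : 0 ≤ x) (hn : n ≤ 1) (hxn : x ≤ n)
    (hw1 : 1 ≤ w) :
    x ^ 2 * (1 + x) ^ (-(2 * ρ)) * (1 + n) ^ (4 * ρ) * w ^ (-modExp ρ) ≤ 8 * x ^ 2 := by
  have hg0 : 0 ≤ modExp ρ := by unfold modExp; linarith
  have e1 : w ^ (-modExp ρ) ≤ 1 := Real.rpow_le_one_of_one_le_of_nonpos hw1 (by linarith)
  have e2 : (1 + x) ^ (-(2 * ρ)) ≤ 1 :=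
    Real.rpow_le_one_of_one_le_of_nonpos (by linarith) (by linarith)
  have e3 : (1 + n) ^ (4 * ρ) ≤ 8 := by
    calc (1 + n) ^ (4 * ρ) ≤ 2 ^ (4 * ρ) :=
          Real.rpow_le_rpow (by linarith) (by linarith) (by linarith)
      _ ≤ 2 ^ (3 : ℝ) := Real.rpow_le_rpow_of_exponent_le (by norm_num) (by linarith)
      _ = 8 := by norm_num
  have e4 : 0 ≤ (1 + n) ^ (4 * ρ) := Real.rpow_nonneg (by linarith) _
  have e5 : 0 ≤ w ^ (-modExp ρ) := Real.rpow_nonneg (by linarith) _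
  calc x ^ 2 * (1 + x) ^ (-(2 * ρ)) * (1 + n) ^ (4 * ρ) * w ^ (-modExp ρ)
      ≤ x ^ 2 * 1 * 8 * 1 := by gcongr
    _ = 8 * x ^ 2 := by ring

/-- The output frequency `x` is odd and its modulation dominates. -/
lemma outer_le_same (h1 : 5 / 8 ≤ ρ) (h2 : ρ < 3 / 4) (hx : 0 ≤ x) (hy : 0 ≤ y)
    (hn : n = max x y) (hw1 : 1 ≤ w) (hw : x * n ^ 2 / 4 ≤ w) :
    x ^ 2 * (1 + x) ^ (-(2 * ρ)) * (1 + n) ^ (4 * ρ) * w ^ (-modExp ρ) ≤ 32 * (√x + x * y) := by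
  have hxn : x ≤ n := hn ▸ le_max_left _ _
  have hs := Real.sqrt_nonneg x
  have hxy : 0 ≤ x * y := by positivity
  rcases le_total n 1 with hn1 | hn1
  · refine (outer_small h1 h2 hx hn1 hxn hw1).trans ?_
    have : x ^ 2 ≤ √x := by
      have hs1 : √x ≤ 1 := Real.sqrt_le_one.2 (hxn.trans hn1)
      calc x ^ 2 = √x ^ 4 := by rw [show (4 : ℕ) = 2 * 2 from rfl, pow_mul, Real.sq_sqrt hx]
        _ ≤ √x := pow_le_of_le_one hs hs1 (by norm_num)
    nlinarith
  · rcases hx.eq_or_lt with rfl | hx0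
    · simp
    refine (outer_aux h1 h2 hx0 hn1 hw).trans ?_
    gcongr
    rcases max_choice x y with h | h
    · rw [h] at hn
      subst hn
      calc n ^ (2 - modExp ρ) * (1 + n) ^ (-(2 * ρ)) * n ^ (4 * ρ - 2 * modExp ρ)
          ≤ n ^ (2 - modExp ρ) * n ^ (-(2 * ρ)) * n ^ (4 * ρ - 2 * modExp ρ) := by
            gcongr ?_ * ?_ * ?_
            exact Real.rpow_le_rpow_of_nonpos hx0 (by linarith) (by linarith)
        -- The total exponent is `2 + 2ρ - 3 modExp ρ = 1/2`; this equation determines `modExp`.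
        _ = √n := by
            rw [← Real.rpow_add hx0, ← Real.rpow_add hx0, Real.sqrt_eq_rpow]
            congr 1
            unfold modExp
            ring
        _ ≤ _ := by linarith
    · rw [h] at hn
      subst hn
      have e1 : x ^ (2 - modExp ρ) * (1 + x) ^ (-(2 * ρ)) ≤ x := by
        calc x ^ (2 - modExp ρ) * (1 + x) ^ (-(2 * ρ))
            = x * (x ^ (1 - modExp ρ) * (1 + x) ^ (-(2 * ρ))) := by
              rw [show 2 - modExp ρ = 1 + (1 - modExp ρ) by ring, Real.rpow_add hx0, Real.rpow_one]
              ring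
          _ ≤ x * ((1 + x) ^ (1 - modExp ρ) * (1 + x) ^ (-(2 * ρ))) := by
              gcongr
              · unfold modExp; linarith
              · linarith
          _ = x * (1 + x) ^ (1 - modExp ρ - 2 * ρ) := by
              rw [← Real.rpow_add (by linarith), sub_eq_add_neg (1 - modExp ρ)]
          _ ≤ x * 1 := by
              gcongr
              exact Real.rpow_le_one_of_one_le_of_nonpos (by linarith) (by unfold modExp; linarith)
          _ = x := mul_one x
      have e2 : n ^ (4 * ρ - 2 * modExp ρ) ≤ n := by
        calc n ^ (4 * ρ - 2 * modExp ρ) ≤ n ^ (1 : ℝ) :=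
              Real.rpow_le_rpow_of_exponent_le hn1 (by unfold modExp; linarith)
          _ = n := Real.rpow_one n
      calc _ ≤ x * n := by gcongr
        _ ≤ _ := by linarith

/-- The output frequency `x` is odd and another modulation dominates. -/
lemma outer_le_opposite (h1 : 5 / 8 ≤ ρ) (h2 : ρ < 3 / 4) (hx : 0 ≤ x) (hxn : x ≤ n)
    (hw1 : 1 ≤ w) (hw : x * n ^ 2 / 4 ≤ w) :
    x ^ 2 * (1 + x) ^ (-(2 * ρ)) * (1 + n) ^ (4 * ρ) * w ^ (-modExp ρ) ≤ 32 * (1 + n ^ 2) := by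
  rcases le_total n 1 with hn1 | hn1
  · refine (outer_small h1 h2 hx hn1 hxn hw1).trans ?_
    nlinarith
  · rcases hx.eq_or_lt with rfl | hx0
    · simp; positivity
    refine (outer_aux h1 h2 hx0 hn1 hw).trans ?_
    gcongr
    -- The exponent `2 - modExp ρ - 2ρ = 3/2 - 8ρ/3` is nonpositive once `ρ ≥ 9/16`; this is where
    -- `ρ` must not be too small.
    have e1 : x ^ (2 - modExp ρ) * (1 + x) ^ (-(2 * ρ)) ≤ 1 := by
      calc x ^ (2 - modExp ρ) * (1 + x) ^ (-(2 * ρ))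
          ≤ (1 + x) ^ (2 - modExp ρ) * (1 + x) ^ (-(2 * ρ)) := by
            gcongr
            · unfold modExp; linarith
            · linarith
        _ = (1 + x) ^ (2 - modExp ρ - 2 * ρ) := by
            rw [← Real.rpow_add (by linarith), sub_eq_add_neg (2 - modExp ρ)]
        _ ≤ 1 := Real.rpow_le_one_of_one_le_of_nonpos (by linarith) (by unfold modExp; linarith)
    have e2 : n ^ (4 * ρ - 2 * modExp ρ) ≤ n := by
      calc n ^ (4 * ρ - 2 * modExp ρ) ≤ n ^ (1 : ℝ) :=
            Real.rpow_le_rpow_of_exponent_le hn1 (by unfold modExp; linarith)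
        _ = n := Real.rpow_one n
    calc _ ≤ 1 * n := by gcongr
      _ ≤ _ := by nlinarith

lemma inner_aux (h1 : 5 / 8 ≤ ρ) (h2 : ρ < 3 / 4) (hx : 1 ≤ x) (hxn : x ≤ n)
    (hw : x * n ^ 2 / 4 ≤ w) :
    (1 + n) ^ 2 * (1 + x) ^ (2 * ρ) * w ^ (-modExp ρ) ≤
      64 * (n ^ (2 - 2 * modExp ρ) * x ^ (2 * ρ - modExp ρ)) := by
  have hg0 : 0 ≤ modExp ρ := by unfold modExp; linarith
  have hg1 : modExp ρ ≤ 1 := by unfold modExp; linarith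
  have hx0 : 0 < x := by linarith
  have hn0 : 0 < n := by linarith
  have e1 := rpow_neg_le_of_mul_sq_le hx0 hn0 hg0 hg1 hw
  have e2 := one_add_rpow_le hx (e := 2 * ρ) (by linarith) (k := 2) (by norm_num; linarith)
  have e3 : (1 + n) ^ 2 ≤ (2 * n) ^ 2 := by gcongr; linarith
  calc (1 + n) ^ 2 * (1 + x) ^ (2 * ρ) * w ^ (-modExp ρ)
      ≤ (2 * n) ^ 2 * (2 ^ 2 * x ^ (2 * ρ)) *
        (4 * x ^ (-modExp ρ) * n ^ (-(2 * modExp ρ))) := by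
        have : 0 ≤ w ^ (-modExp ρ) := Real.rpow_nonneg (le_trans (by positivity) hw) _
        gcongr
    _ = _ := by
        rw [sub_eq_add_neg, sub_eq_add_neg, Real.rpow_add hx0, Real.rpow_add hn0, Real.rpow_two]
        ring

/-- An input frequency `x` is odd and its modulation dominates. -/
lemma inner_le_same (h1 : 5 / 8 ≤ ρ) (h2 : ρ < 3 / 4) (hx : 1 ≤ x) (hy : 0 ≤ y)
    (hn : n = max x y) (hw : x * n ^ 2 / 4 ≤ w) :
    (1 + n) ^ 2 * (1 + x) ^ (2 * ρ) * w ^ (-modExp ρ) ≤ 64 * (√x + x * y) := by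
  have hxn : x ≤ n := hn ▸ le_max_left _ _
  have hn1 : 1 ≤ n := hx.trans hxn
  have hx0 : 0 < x := by linarith
  have hs := Real.sqrt_nonneg x
  have hxy : 0 ≤ x * y := by positivity
  refine (inner_aux h1 h2 hx hxn hw).trans ?_
  gcongr
  rcases max_choice x y with h | h
  · rw [h] at hn
    subst hn
    -- Again `2 + 2ρ - 3 modExp ρ = 1/2`: the critical case is the same for an odd input.
    have : n ^ (2 - 2 * modExp ρ) * n ^ (2 * ρ - modExp ρ) = √n := by
      rw [← Real.rpow_add hx0, Real.sqrt_eq_rpow]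
      congr 1
      unfold modExp
      ring
    linarith
  · rw [h] at hn
    subst hn
    calc n ^ (2 - 2 * modExp ρ) * x ^ (2 * ρ - modExp ρ) ≤ n ^ (1 : ℝ) * x ^ (1 : ℝ) := by
          gcongr ?_ * ?_
          · exact Real.rpow_le_rpow_of_exponent_le hn1 (by unfold modExp; linarith)
          · exact Real.rpow_le_rpow_of_exponent_le hx (by unfold modExp; linarith)
      _ ≤ _ := by rw [Real.rpow_one, Real.rpow_one]; linarith

/-- An input frequency `x` is odd and another modulation dominates. -/
lemma inner_le_opposite (h1 : 5 / 8 ≤ ρ) (h2 : ρ < 3 / 4) (hx : 1 ≤ x) (hxn : x ≤ n)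
    (hw : x * n ^ 2 / 4 ≤ w) :
    (1 + n) ^ 2 * (1 + x) ^ (2 * ρ) * w ^ (-modExp ρ) ≤ 64 * (1 + n ^ 2) := by
  have hn1 : 1 ≤ n := hx.trans hxn
  have hn0 : 0 < n := by linarith
  refine (inner_aux h1 h2 hx hxn hw).trans ?_
  gcongr
  calc n ^ (2 - 2 * modExp ρ) * x ^ (2 * ρ - modExp ρ)
      ≤ n ^ (2 - 2 * modExp ρ) * n ^ (2 * ρ - modExp ρ) := by
        gcongr
        unfold modExp; linarith
    _ = n ^ (2 - 2 * modExp ρ + (2 * ρ - modExp ρ)) := by rw [Real.rpow_add hn0]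
    _ ≤ n ^ (2 : ℝ) := Real.rpow_le_rpow_of_exponent_le hn1 (by unfold modExp; linarith)
    _ ≤ _ := by rw [Real.rpow_two]; linarith

lemma inner_le_of_le_one (h1 : 5 / 8 ≤ ρ) (h2 : ρ < 3 / 4) (hx : 0 ≤ x) (hx1 : x ≤ 1) :
    (1 + n) ^ 2 * (1 + x) ^ (2 * ρ) ≤ 64 * (1 + n ^ 2) := by
  have e1 : (1 + x) ^ (2 * ρ) ≤ 4 := by
    calc (1 + x) ^ (2 * ρ) ≤ 2 ^ (2 * ρ) :=
          Real.rpow_le_rpow (by linarith) (by linarith) (by linarith)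
      _ ≤ 2 ^ (2 : ℝ) := Real.rpow_le_rpow_of_exponent_le (by norm_num) (by linarith)
      _ = 4 := by norm_num
  calc (1 + n) ^ 2 * (1 + x) ^ (2 * ρ) ≤ (1 + n) ^ 2 * 4 := by gcongr
    _ ≤ _ := by nlinarith [sq_nonneg (n - 1)]

end

/-- The factor of the kernel that belongs to two frequencies `x, y` with dispersion signs
`α, β`. -/
def gain (α β x y : ℝ) : ℝ := if α = β then √|x + y| + |x + y| * |x - y| else 1 + x ^ 2 + y ^ 2

lemma gain_nonneg (α β x y : ℝ) : 0 ≤ gain α β x y := by unfold gain; split_ifs <;> positivity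

lemma gain_comm (α β x y : ℝ) : gain α β x y = gain β α y x := by
  unfold gain
  simp only [eq_comm (a := α), add_comm x y, abs_sub_comm x y]
  congr 1
  ring

/-- The squared kernel that is left after the multiplier has been estimated. -/
def pairKernel (r α β : ℝ) (p q : ℝ × ℝ) : ℝ :=
  gain α β p.1 q.1 * bracket (p.2 + α * p.1 ^ 3) ^ (-r) * bracket (q.2 + β * q.1 ^ 3) ^ (-r)

lemma pairKernel_nonneg (r α β : ℝ) (p q : ℝ × ℝ) : 0 ≤ pairKernel r α β p q :=
  mul_nonneg (mul_nonneg (gain_nonneg _ _ _ _) (Real.rpow_nonneg (bracket_pos _).le _))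
    (Real.rpow_nonneg (bracket_pos _).le _)

lemma pairKernel_comm (r α β : ℝ) (p q : ℝ × ℝ) : pairKernel r α β p q = pairKernel r β α q p := by
  unfold pairKernel
  rw [gain_comm]
  ring

/-- The Fourier multiplier of `(u, v) ↦ (uv)_x` relative to the weights of the spaces. -/
def symbol (a₁ a₂ a s b b' : ℝ) (p q : ℝ × ℝ) : ℝ :=
  |(p + q).1| * weight a s b' (p + q) / (weight a₁ s b p * weight a₂ s b q)

/-! ### From the multiplier to pair kernels by resonance. -/

lemma bracket_add_le_mul (x y : ℝ) : bracket (x + y) ≤ bracket x * bracket y := by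
  unfold bracket
  nlinarith [abs_add_le x y, mul_nonneg (abs_nonneg x) (abs_nonneg y)]

lemma bracket_mono {x y : ℝ} (h : |x| ≤ |y|) : bracket x ≤ bracket y := by
  unfold bracket; linarith

/-- Regularity `s ≥ -ρ` is no worse than `-ρ`: the surplus power `s + ρ ≥ 0` of the output bracket
is absorbed by the inputs, since the bracket is submultiplicative. -/
lemma symbol_sq_le {a₁ a₂ a s b b' ρ : ℝ} (hs : -ρ ≤ s) (p q : ℝ × ℝ) :
    symbol a₁ a₂ a s b b' p q ^ 2 ≤
      ((p.1 + q.1) ^ 2 * bracket (p.1 + q.1) ^ (-(2 * ρ)) * bracket p.1 ^ (2 * ρ) *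
        bracket q.1 ^ (2 * ρ)) *
      (bracket ((p + q).2 + a * (p + q).1 ^ 3) ^ (2 * b') *
        bracket (p.2 + a₁ * p.1 ^ 3) ^ (-(2 * b)) * bracket (q.2 + a₂ * q.1 ^ 3) ^ (-(2 * b))) := by
  have h0 := bracket_pos (p.1 + q.1)
  have h1 := bracket_pos p.1
  have h2 := bracket_pos q.1
  have key : bracket (p.1 + q.1) ^ (2 * s) * bracket p.1 ^ (-(2 * s)) * bracket q.1 ^ (-(2 * s)) ≤
      bracket (p.1 + q.1) ^ (-(2 * ρ)) * bracket p.1 ^ (2 * ρ) * bracket q.1 ^ (2 * ρ) := by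
    have e0 : bracket (p.1 + q.1) ^ (2 * s) =
        bracket (p.1 + q.1) ^ (-(2 * ρ)) * bracket (p.1 + q.1) ^ (2 * (s + ρ)) := by
      rw [← Real.rpow_add h0]; congr 1; ring
    have e1 {x : ℝ} (hx : 0 < x) : x ^ (2 * ρ) = x ^ (-(2 * s)) * x ^ (2 * (s + ρ)) := by
      rw [← Real.rpow_add hx]; congr 1; ring
    rw [e0, e1 h1, e1 h2]
    have e3 : bracket (p.1 + q.1) ^ (2 * (s + ρ)) ≤
        bracket p.1 ^ (2 * (s + ρ)) * bracket q.1 ^ (2 * (s + ρ)) := by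
      rw [← Real.mul_rpow h1.le h2.le]
      exact Real.rpow_le_rpow h0.le (bracket_add_le_mul _ _) (by linarith)
    calc _ = bracket (p.1 + q.1) ^ (-(2 * ρ)) * bracket p.1 ^ (-(2 * s)) *
          bracket q.1 ^ (-(2 * s)) * bracket (p.1 + q.1) ^ (2 * (s + ρ)) := by ring
      _ ≤ bracket (p.1 + q.1) ^ (-(2 * ρ)) * bracket p.1 ^ (-(2 * s)) *
          bracket q.1 ^ (-(2 * s)) *
          (bracket p.1 ^ (2 * (s + ρ)) * bracket q.1 ^ (2 * (s + ρ))) := by gcongr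
      _ = _ := by ring
  have hσ (x : ℝ) : 0 ≤ bracket x := (bracket_pos x).le
  calc symbol a₁ a₂ a s b b' p q ^ 2
      = (p.1 + q.1) ^ 2 * (bracket (p.1 + q.1) ^ (2 * s) * bracket p.1 ^ (-(2 * s)) *
          bracket q.1 ^ (-(2 * s))) *
        (bracket ((p + q).2 + a * (p + q).1 ^ 3) ^ (2 * b') *
          bracket (p.2 + a₁ * p.1 ^ 3) ^ (-(2 * b)) *
          bracket (q.2 + a₂ * q.1 ^ 3) ^ (-(2 * b))) := by
        unfold symbol
        rw [div_pow, mul_pow, mul_pow, weight_sq, weight_sq, weight_sq, sq_abs,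
          Real.rpow_neg h1.le, Real.rpow_neg h2.le, Real.rpow_neg (hσ _), Real.rpow_neg (hσ _),
          div_eq_mul_inv, mul_inv, mul_inv, mul_inv, Prod.fst_add]
        ring
    _ ≤ (p.1 + q.1) ^ 2 * (bracket (p.1 + q.1) ^ (-(2 * ρ)) * bracket p.1 ^ (2 * ρ) *
          bracket q.1 ^ (2 * ρ)) * _ := by
        gcongr
        have := Real.rpow_nonneg (hσ ((p + q).2 + a * (p + q).1 ^ 3)) (2 * b')
        have := Real.rpow_nonneg (hσ (p.2 + a₁ * p.1 ^ 3)) (-(2 * b))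
        have := Real.rpow_nonneg (hσ (q.2 + a₂ * q.1 ^ 3)) (-(2 * b))
        positivity
    _ = _ := by ring

/-- The output carries the weaker exponent `g`. This lets it trade exponents with a larger input
modulation, so that the dominating modulation always has exponent `g` and the other two have `r`. -/
lemma bracket_rpow_swap {g r x y : ℝ} (hgr : g ≤ r) (h : |x| ≤ |y|) :
    bracket x ^ (-g) * bracket y ^ (-r) ≤ bracket x ^ (-r) * bracket y ^ (-g) := by
  have hx := bracket_pos x
  have hy := bracket_pos y
  have e (t : ℝ) (ht : 0 < t) : t ^ (-g) = t ^ (-r) * t ^ (r - g) := by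
    rw [← Real.rpow_add ht]; congr 1; ring
  rw [e _ hx, e _ hy, mul_right_comm, ← mul_assoc]
  gcongr
  exact bracket_mono h

/-- The largest of three modulations is at least a third of the resonance function. -/
lemma mul_modulation_le {g r M C H σ₀ σ₁ σ₂ Q₀ Q₁ Q₂ : ℝ} (hgr : g ≤ r) (hM : 0 ≤ M)
    (hC : 0 ≤ C) (hQ₀ : 0 ≤ Q₀) (hQ₁ : 0 ≤ Q₁) (hQ₂ : 0 ≤ Q₂) (hH : σ₀ + σ₁ + σ₂ = H)
    (h₀ : |H| ≤ 3 * |σ₀| → M * bracket σ₀ ^ (-g) ≤ C * Q₀)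
    (h₁ : |H| ≤ 3 * |σ₁| → M * bracket σ₁ ^ (-g) ≤ C * Q₁)
    (h₂ : |H| ≤ 3 * |σ₂| → M * bracket σ₂ ^ (-g) ≤ C * Q₂) :
    M * (bracket σ₀ ^ (-g) * bracket σ₁ ^ (-r) * bracket σ₂ ^ (-r)) ≤
      C * (Q₀ * bracket σ₁ ^ (-r) * bracket σ₂ ^ (-r) +
        Q₁ * bracket σ₀ ^ (-r) * bracket σ₂ ^ (-r) +
        Q₂ * bracket σ₀ ^ (-r) * bracket σ₁ ^ (-r)) := by
  have hd (σ e : ℝ) : 0 ≤ bracket σ ^ e := Real.rpow_nonneg (bracket_pos σ).le e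
  have t₀ : 0 ≤ C * (Q₀ * bracket σ₁ ^ (-r) * bracket σ₂ ^ (-r)) := by
    have := hd σ₁ (-r); have := hd σ₂ (-r); positivity
  have t₁ : 0 ≤ C * (Q₁ * bracket σ₀ ^ (-r) * bracket σ₂ ^ (-r)) := by
    have := hd σ₀ (-r); have := hd σ₂ (-r); positivity
  have t₂ : 0 ≤ C * (Q₂ * bracket σ₀ ^ (-r) * bracket σ₁ ^ (-r)) := by
    have := hd σ₀ (-r); have := hd σ₁ (-r); positivity
  have hHle : |H| ≤ |σ₀| + |σ₁| + |σ₂| := by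
    rw [← hH]; exact (abs_add_le _ _).trans (by gcongr; exact abs_add_le _ _)
  rw [mul_add, mul_add]
  by_cases c₀ : |σ₁| ≤ |σ₀| ∧ |σ₂| ≤ |σ₀|
  · have := h₀ (by linarith [c₀.1, c₀.2])
    calc _ = M * bracket σ₀ ^ (-g) * (bracket σ₁ ^ (-r) * bracket σ₂ ^ (-r)) := by ring
      _ ≤ C * Q₀ * (bracket σ₁ ^ (-r) * bracket σ₂ ^ (-r)) :=
          mul_le_mul_of_nonneg_right this (mul_nonneg (hd _ _) (hd _ _))
      _ ≤ _ := by linarith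
  · by_cases c₁ : |σ₀| ≤ |σ₁| ∧ |σ₂| ≤ |σ₁|
    · have := h₁ (by linarith [c₁.1, c₁.2])
      calc _ = M * ((bracket σ₀ ^ (-g) * bracket σ₁ ^ (-r)) * bracket σ₂ ^ (-r)) := by ring
        _ ≤ M * ((bracket σ₀ ^ (-r) * bracket σ₁ ^ (-g)) * bracket σ₂ ^ (-r)) :=
            mul_le_mul_of_nonneg_left (mul_le_mul_of_nonneg_right
              (bracket_rpow_swap hgr c₁.1) (hd _ _)) hM
        _ = M * bracket σ₁ ^ (-g) * (bracket σ₀ ^ (-r) * bracket σ₂ ^ (-r)) := by ring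
        _ ≤ C * Q₁ * (bracket σ₀ ^ (-r) * bracket σ₂ ^ (-r)) :=
            mul_le_mul_of_nonneg_right this (mul_nonneg (hd _ _) (hd _ _))
        _ ≤ _ := by linarith
    · have c₂ : |σ₀| ≤ |σ₂| ∧ |σ₁| ≤ |σ₂| := by
        rw [not_and_or, not_le, not_le] at c₀ c₁
        rcases c₀ with h | h <;> rcases c₁ with h' | h' <;> constructor <;> linarith
      have := h₂ (by linarith [c₂.1, c₂.2])
      calc _ = M * ((bracket σ₀ ^ (-g) * bracket σ₂ ^ (-r)) * bracket σ₁ ^ (-r)) := by ring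
        _ ≤ M * ((bracket σ₀ ^ (-r) * bracket σ₂ ^ (-g)) * bracket σ₁ ^ (-r)) :=
            mul_le_mul_of_nonneg_left (mul_le_mul_of_nonneg_right
              (bracket_rpow_swap hgr c₂.1) (hd _ _)) hM
        _ = M * bracket σ₂ ^ (-g) * (bracket σ₀ ^ (-r) * bracket σ₁ ^ (-r)) := by ring
        _ ≤ C * Q₂ * (bracket σ₀ ^ (-r) * bracket σ₁ ^ (-r)) :=
            mul_le_mul_of_nonneg_right this (mul_nonneg (hd _ _) (hd _ _))
        _ ≤ _ := by linarith

/-- The resonance function: with unequal signs it controls the square of the frequencies. -/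
lemma resonance_le {α x y z : ℝ} (hα : |α| = 1) (h : x + y + z = 0) :
    3 / 4 * (|x| * (|y| + |z|) ^ 2) ≤ |α * x ^ 3 - α * y ^ 3 - α * z ^ 3| := by
  -- As `y³ + z³ = -x(y² - yz + z²)`, the factor `x` splits off and a positive definite quadratic
  -- form in `y, z` remains. It exceeds `3/4 (|y| + |z|)²` by at least `5/4 (|y| - |z|)²`.
  have e : α * x ^ 3 - α * y ^ 3 - α * z ^ 3 = α * (x * (2 * y ^ 2 + y * z + 2 * z ^ 2)) := by
    obtain rfl : x = -y - z := by linarith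
    ring
  rw [e, abs_mul, hα, one_mul, abs_mul, ← mul_left_comm]
  gcongr
  refine le_trans ?_ (le_abs_self _)
  have h1 : -(|y| * |z|) ≤ y * z := by rw [← abs_mul]; exact neg_abs_le _
  nlinarith [sq_nonneg (|y| - |z|), sq_abs y, sq_abs z]

/-- For two frequencies of equal sign, `|x + y|` is the size of the odd frequency and `|x - y|` is
the other factor of `gain`. The two entries of the maximum are the two cases of `outer_le_same` and
`inner_le_same`. -/
lemma add_abs_eq_max (x y : ℝ) : |x| + |y| = max |x + y| |x - y| := by
  rcases abs_cases x with h | h <;> rcases abs_cases y with h' | h' <;>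
  rcases abs_cases (x + y) with h'' | h'' <;> rcases abs_cases (x - y) with h3 | h3 <;>
  rcases max_cases |x + y| |x - y| with h4 | h4 <;> linarith

lemma one_add_sq_le_gain {α β x y z : ℝ} (hαβ : α ≠ β) (h : x + y + z = 0) :
    1 + (|y| + |z|) ^ 2 ≤ 8 * gain α β x z := by
  rw [gain, if_neg hαβ]
  have h1 : |y| ≤ |x| + |z| := by
    rw [show y = -(x + z) by linarith, abs_neg]; exact abs_add_le _ _
  have h2 : (|y| + |z|) ^ 2 ≤ (|x| + 2 * |z|) ^ 2 :=
    pow_le_pow_left₀ (by positivity) (by linarith) 2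
  nlinarith [sq_abs x, sq_abs z, sq_nonneg (|x| - 2 * |z|)]

lemma quarter_le_bracket {α x y z σ : ℝ} (hα : |α| = 1) (h : x + y + z = 0)
    (hσ : |α * x ^ 3 - α * y ^ 3 - α * z ^ 3| ≤ 3 * |σ|) :
    |x| * (|y| + |z|) ^ 2 / 4 ≤ bracket σ := by
  have := resonance_le hα h
  unfold bracket
  linarith

/-- In the zero-sum variables `-(p + q), p, q` the signs are `a, -a, -a`. If the output modulation
dominates, the remaining pair has equal signs; if an input modulation dominates, it has opposite
signs. -/
lemma symbol_sq_le_of_output_odd {a s b ρ : ℝ} (ha : |a| = 1) (h1 : 5 / 8 ≤ ρ) (h2 : ρ < 3 / 4)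
    (hs : -ρ ≤ s) (hb : 1 / 2 < b) (p q : ℝ × ℝ) :
    symbol (-a) (-a) a s b (-(modExp ρ / 2)) p q ^ 2 ≤
      512 * (pairKernel (2 * b) (-a) (-a) p q + pairKernel (2 * b) a (-a) (-(p + q)) q +
        pairKernel (2 * b) a (-a) (-(p + q)) p) := by
  have ha0 : a ≠ -a := fun h => by
    have : a = 0 := by linarith
    simp [this] at ha
  refine (symbol_sq_le hs p q).trans ?_
  have hsum : -(p.1 + q.1) + p.1 + q.1 = 0 := by ring
  -- The modulation is odd and the bracket even, so the output may be reflected; then the `τ`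
  -- variables cancel in the sum of the modulations.
  have hσ₀ : bracket ((p + q).2 + a * (p + q).1 ^ 3) =
      bracket ((-(p + q)).2 + a * (-(p + q)).1 ^ 3) := by
    rw [← bracket_neg]
    congr 1
    simp only [Prod.fst_neg, Prod.snd_neg]
    ring
  set x := |p.1 + q.1| with hx
  set n := |p.1| + |q.1| with hn
  have hx' : |-(p.1 + q.1)| = x := abs_neg _
  have hxn : x ≤ n := abs_add_le _ _
  have hn0 : 0 ≤ n := by positivity
  have hβ₁ : bracket p.1 ≤ 1 + n := by unfold bracket; linarith [abs_nonneg q.1]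
  have hβ₂ : bracket q.1 ≤ 1 + n := by unfold bracket; linarith [abs_nonneg p.1]
  have hM0 : 0 ≤ (p.1 + q.1) ^ 2 * bracket (p.1 + q.1) ^ (-(2 * ρ)) * bracket p.1 ^ (2 * ρ) *
      bracket q.1 ^ (2 * ρ) := by
    have := bracket_pos (p.1 + q.1); have := bracket_pos p.1; have := bracket_pos q.1
    positivity
  have hM : (p.1 + q.1) ^ 2 * bracket (p.1 + q.1) ^ (-(2 * ρ)) * bracket p.1 ^ (2 * ρ) *
      bracket q.1 ^ (2 * ρ) ≤ x ^ 2 * (1 + x) ^ (-(2 * ρ)) * (1 + n) ^ (4 * ρ) := by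
    rw [show 4 * ρ = 2 * ρ + 2 * ρ by ring, Real.rpow_add (by linarith), ← mul_assoc, hx, sq_abs]
    have := bracket_pos p.1; have := bracket_pos q.1
    have hb0 := bracket_pos (p.1 + q.1)
    change _ ≤ (p.1 + q.1) ^ 2 * bracket (p.1 + q.1) ^ (-(2 * ρ)) * _ * _
    gcongr
  have key := mul_modulation_le (g := modExp ρ) (r := 2 * b) (C := 512)
    (M := (p.1 + q.1) ^ 2 * bracket (p.1 + q.1) ^ (-(2 * ρ)) * bracket p.1 ^ (2 * ρ) *
      bracket q.1 ^ (2 * ρ))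
    (H := a * (-(p.1 + q.1)) ^ 3 - a * p.1 ^ 3 - a * q.1 ^ 3)
    (σ₀ := (-(p + q)).2 + a * (-(p + q)).1 ^ 3)
    (σ₁ := p.2 + -a * p.1 ^ 3) (σ₂ := q.2 + -a * q.1 ^ 3)
    (Q₀ := gain (-a) (-a) p.1 q.1) (Q₁ := gain a (-a) (-(p + q)).1 q.1)
    (Q₂ := gain a (-a) (-(p + q)).1 p.1)
    (by unfold modExp; linarith) hM0 (by norm_num) (gain_nonneg _ _ _ _) (gain_nonneg _ _ _ _)
    (gain_nonneg _ _ _ _) (by simp only [Prod.fst_neg, Prod.snd_neg, Prod.fst_add, Prod.snd_add]; ring)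
    ?_ ?_ ?_
  · rw [hσ₀, show 2 * -(modExp ρ / 2) = -modExp ρ by ring]
    exact key
  · intro hσ
    have hw := quarter_le_bracket ha hsum hσ
    rw [hx'] at hw
    calc _ ≤ x ^ 2 * (1 + x) ^ (-(2 * ρ)) * (1 + n) ^ (4 * ρ) * _ :=
          mul_le_mul_of_nonneg_right hM (Real.rpow_nonneg (bracket_pos _).le _)
      _ ≤ 32 * (√x + x * |p.1 - q.1|) := outer_le_same h1 h2 (abs_nonneg _) (abs_nonneg _)
          (add_abs_eq_max _ _) (one_le_bracket _) hw
      _ ≤ _ := by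
          rw [gain, if_pos rfl]
          have : 0 ≤ √x + x * |p.1 - q.1| := by positivity
          linarith
  · intro hσ
    have hw := quarter_le_bracket ha hsum hσ
    rw [hx'] at hw
    calc _ ≤ x ^ 2 * (1 + x) ^ (-(2 * ρ)) * (1 + n) ^ (4 * ρ) * _ :=
          mul_le_mul_of_nonneg_right hM (Real.rpow_nonneg (bracket_pos _).le _)
      _ ≤ 32 * (1 + n ^ 2) := outer_le_opposite h1 h2 (abs_nonneg _) hxn (one_le_bracket _) hw
      _ ≤ _ := by
          have := one_add_sq_le_gain (y := p.1) (z := q.1) ha0 hsum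
          have := gain_nonneg a (-a) (-(p + q)).1 q.1
          simp only [Prod.fst_neg, Prod.fst_add] at *
          linarith
  · intro hσ
    have hw := quarter_le_bracket ha hsum hσ
    rw [hx'] at hw
    calc _ ≤ x ^ 2 * (1 + x) ^ (-(2 * ρ)) * (1 + n) ^ (4 * ρ) * _ :=
          mul_le_mul_of_nonneg_right hM (Real.rpow_nonneg (bracket_pos _).le _)
      _ ≤ 32 * (1 + n ^ 2) := outer_le_opposite h1 h2 (abs_nonneg _) hxn (one_le_bracket _) hw
      _ ≤ _ := by
          have := one_add_sq_le_gain (y := q.1) (z := p.1) ha0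
            (show -(p.1 + q.1) + q.1 + p.1 = 0 by ring)
          have := gain_nonneg a (-a) (-(p + q)).1 p.1
          rw [add_comm |q.1|] at *
          simp only [Prod.fst_neg, Prod.fst_add] at *
          linarith

/-- The signs at `-(p + q), p, q` are now `a, -a, a`, so `p` is odd. The remaining pair has equal
signs only when the modulation of `p` dominates. -/
lemma symbol_sq_le_of_input_odd {a s b ρ : ℝ} (ha : |a| = 1) (h1 : 5 / 8 ≤ ρ) (h2 : ρ < 3 / 4)
    (hs : -ρ ≤ s) (hb : 1 / 2 < b) (p q : ℝ × ℝ) :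
    symbol (-a) a a s b (-(modExp ρ / 2)) p q ^ 2 ≤
      512 * (pairKernel (2 * b) (-a) a p q + pairKernel (2 * b) a a (-(p + q)) q +
        pairKernel (2 * b) a (-a) (-(p + q)) p) := by
  have ha0 : -a ≠ a := fun h => by
    have : a = 0 := by linarith
    simp [this] at ha
  refine (symbol_sq_le hs p q).trans ?_
  have hsum : p.1 + -(p.1 + q.1) + q.1 = 0 := by ring
  have hsum' : p.1 + q.1 + -(p.1 + q.1) = 0 := by ring
  have hσ₀ : bracket ((p + q).2 + a * (p + q).1 ^ 3) =
      bracket ((-(p + q)).2 + a * (-(p + q)).1 ^ 3) := by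
    rw [← bracket_neg]
    congr 1
    simp only [Prod.fst_neg, Prod.snd_neg]
    ring
  set x := |p.1| with hx
  set n := |-(p.1 + q.1)| + |q.1| with hn
  have hnabs : n = |p.1 + q.1| + |q.1| := by rw [hn, abs_neg]
  have hmax : n = max x |-(p.1 + q.1) - q.1| := by
    rw [hn, add_abs_eq_max, show -(p.1 + q.1) + q.1 = -p.1 by ring, abs_neg]
  have hxn : x ≤ n := hmax ▸ le_max_left _ _
  have hn0 : 0 ≤ n := by positivity
  have hb0 := bracket_pos (p.1 + q.1)
  have hb1 := bracket_pos p.1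
  have hb2 := bracket_pos q.1
  have hM0 : 0 ≤ (p.1 + q.1) ^ 2 * bracket (p.1 + q.1) ^ (-(2 * ρ)) * bracket p.1 ^ (2 * ρ) *
      bracket q.1 ^ (2 * ρ) := by
    positivity
  have hM : (p.1 + q.1) ^ 2 * bracket (p.1 + q.1) ^ (-(2 * ρ)) * bracket p.1 ^ (2 * ρ) *
      bracket q.1 ^ (2 * ρ) ≤ (1 + n) ^ 2 * (1 + x) ^ (2 * ρ) := by
    -- The derivative outweighs the negative power because `2 - 2ρ > 0`, so the output bracket may
    -- be enlarged to `1 + n`.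
    have e0 : (p.1 + q.1) ^ 2 * bracket (p.1 + q.1) ^ (-(2 * ρ)) ≤ (1 + n) ^ (2 - 2 * ρ) := by
      calc (p.1 + q.1) ^ 2 * bracket (p.1 + q.1) ^ (-(2 * ρ))
          ≤ bracket (p.1 + q.1) ^ 2 * bracket (p.1 + q.1) ^ (-(2 * ρ)) := by
            gcongr ?_ * _
            rw [← sq_abs]
            gcongr
            unfold bracket
            linarith
        _ = bracket (p.1 + q.1) ^ (2 - 2 * ρ) := by
            rw [sub_eq_add_neg, Real.rpow_add hb0, Real.rpow_two]
        _ ≤ _ := by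
            refine Real.rpow_le_rpow hb0.le ?_ (by linarith)
            unfold bracket
            linarith [abs_nonneg q.1]
    have e2 : bracket q.1 ^ (2 * ρ) ≤ (1 + n) ^ (2 * ρ) := by
      refine Real.rpow_le_rpow hb2.le ?_ (by linarith)
      unfold bracket
      linarith [abs_nonneg (p.1 + q.1)]
    calc _ = ((p.1 + q.1) ^ 2 * bracket (p.1 + q.1) ^ (-(2 * ρ))) * bracket q.1 ^ (2 * ρ) *
          bracket p.1 ^ (2 * ρ) := by ring
      _ ≤ (1 + n) ^ (2 - 2 * ρ) * (1 + n) ^ (2 * ρ) * bracket p.1 ^ (2 * ρ) := by gcongr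
      _ = _ := by
          rw [← Real.rpow_add (by linarith), sub_add_cancel, Real.rpow_two]
          rfl
  have hp01 : 1 + n ^ 2 ≤ 8 * gain (-a) a p.1 q.1 := one_add_sq_le_gain ha0 hsum
  have hp02 : 1 + n ^ 2 ≤ 8 * gain a (-a) (-(p + q)).1 p.1 := by
    rw [hn, add_comm |_|, gain_comm]
    exact one_add_sq_le_gain ha0 hsum'
  rw [hσ₀, show 2 * -(modExp ρ / 2) = -modExp ρ by ring]
  -- For `x ≤ 1` no resonance is needed: the multiplier is already controlled by the gain of the
  -- opposite-sign pair `p, q`, and the output modulation is discarded.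
  rcases le_total x 1 with hx1 | hx1
  · have hm := inner_le_of_le_one (n := n) h1 h2 (abs_nonneg p.1) hx1
    have e0 : bracket ((-(p + q)).2 + a * (-(p + q)).1 ^ 3) ^ (-modExp ρ) ≤ 1 :=
      Real.rpow_le_one_of_one_le_of_nonpos (one_le_bracket _) (by unfold modExp; linarith)
    have hd1 := Real.rpow_nonneg (bracket_pos (p.2 + -a * p.1 ^ 3)).le (-(2 * b))
    have hd2 := Real.rpow_nonneg (bracket_pos (q.2 + a * q.1 ^ 3)).le (-(2 * b))
    have k1 := pairKernel_nonneg (2 * b) a a (-(p + q)) q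
    have k2 := pairKernel_nonneg (2 * b) a (-a) (-(p + q)) p
    calc _ ≤ (512 * gain (-a) a p.1 q.1) * (1 * bracket (p.2 + -a * p.1 ^ 3) ^ (-(2 * b)) *
          bracket (q.2 + a * q.1 ^ 3) ^ (-(2 * b))) := by
          have hg := gain_nonneg (-a) a p.1 q.1
          refine mul_le_mul (by linarith) ?_ ?_ (by positivity)
          · gcongr
          · exact mul_nonneg (mul_nonneg (Real.rpow_nonneg (bracket_pos _).le _) hd1) hd2
      _ = 512 * pairKernel (2 * b) (-a) a p q := by unfold pairKernel; ring
      _ ≤ _ := by linarith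
  refine mul_modulation_le (g := modExp ρ) (r := 2 * b) (C := 512)
    (H := a * (-(p.1 + q.1)) ^ 3 - a * p.1 ^ 3 + a * q.1 ^ 3)
    (σ₀ := (-(p + q)).2 + a * (-(p + q)).1 ^ 3)
    (σ₁ := p.2 + -a * p.1 ^ 3) (σ₂ := q.2 + a * q.1 ^ 3)
    (Q₀ := gain (-a) a p.1 q.1) (Q₁ := gain a a (-(p + q)).1 q.1)
    (Q₂ := gain a (-a) (-(p + q)).1 p.1)
    (by unfold modExp; linarith) hM0 (by norm_num) (gain_nonneg _ _ _ _) (gain_nonneg _ _ _ _)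
    (gain_nonneg _ _ _ _) (by simp only [Prod.fst_neg, Prod.snd_neg, Prod.fst_add, Prod.snd_add]; ring)
    ?_ ?_ ?_
  all_goals
    intro hσ
    have hw := quarter_le_bracket (α := -a) (by rwa [abs_neg]) hsum (hσ.trans' (le_of_eq (by congr 1; ring)))
    refine (mul_le_mul_of_nonneg_right hM (Real.rpow_nonneg (bracket_pos _).le _)).trans ?_
  · have := inner_le_opposite h1 h2 hx1 hxn hw
    linarith
  · have := inner_le_same h1 h2 hx1 (abs_nonneg (-(p.1 + q.1) - q.1)) hmax hw
    refine this.trans ?_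
    rw [gain, if_pos rfl, Prod.fst_neg, Prod.fst_add, show -(p.1 + q.1) + q.1 = -p.1 by ring, abs_neg]
    have : 0 ≤ √x + x * |-(p.1 + q.1) - q.1| := by positivity
    linarith
  · have := inner_le_opposite h1 h2 hx1 hxn hw
    linarith

/-! ### The trilinear form -/

lemma measurable_gain (α β : ℝ) : Measurable fun z : ℝ × ℝ => gain α β z.1 z.2 := by
  unfold gain
  split_ifs <;> fun_prop

lemma measurable_pairKernel (r α β : ℝ) :
    Measurable fun z : (ℝ × ℝ) × (ℝ × ℝ) => pairKernel r α β z.1 z.2 := by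
  have h1 := measurable_gain α β
  have h2 : Measurable fun x => bracket x ^ (-r) :=
    (continuous_bracket.rpow_const fun x => Or.inl (bracket_pos x).ne').measurable
  unfold pairKernel
  refine ((h1.comp (by fun_prop : Measurable fun z : (ℝ × ℝ) × (ℝ × ℝ) => (z.1.1, z.2.1))).mul
    (h2.comp (by fun_prop))).mul (h2.comp (by fun_prop))

/-- Integrating in `τ` convolves two integrable powers of the bracket. What remains is the gain
against a power of the phase, which is one of the two change-of-variables bounds; frequencies here
are `q` and `-p - q`, with `p` frozen. -/
lemma exists_lintegral_pairKernel_le {r : ℝ} (hr : 1 < r) {α β : ℝ} (hα : |α| = 1)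
    (hβ : |β| = 1) :
    ∃ C : ℝ≥0∞, C ≠ ∞ ∧ ∀ p, ∫⁻ q, ENNReal.ofReal (pairKernel r α β q (-p - q)) ≤ C := by
  have hr0 : 0 ≤ r := by linarith
  have hI := lintegral_decay_ne_top hr
  have hA : 2 * ENNReal.ofReal (2 ^ r) * ∫⁻ x, decay r x ≠ ∞ :=
    ENNReal.mul_ne_top (ENNReal.mul_ne_top (by simp) ENNReal.ofReal_ne_top) hI
  have hpk (p q : ℝ × ℝ) : ENNReal.ofReal (pairKernel r α β q (-p - q)) =
      ENNReal.ofReal (gain α β q.1 (-p.1 - q.1)) * decay r (q.2 + α * q.1 ^ 3) *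
        decay r (-p.2 - q.2 + β * (-p.1 - q.1) ^ 3) := by
    rw [pairKernel, ENNReal.ofReal_mul (mul_nonneg (gain_nonneg _ _ _ _)
      (Real.rpow_nonneg (bracket_pos _).le _)), ENNReal.ofReal_mul (gain_nonneg _ _ _ _)]
    rfl
  have hm (z : ℝ) : Measurable fun x => ENNReal.ofReal (gain α β x (-z - x)) :=
    ENNReal.measurable_ofReal.comp ((measurable_gain α β).comp
      (by fun_prop : Measurable fun x : ℝ => (x, -z - x)))
  simp only [hpk]
  by_cases hαβ : α = β
  · subst hαβ
    refine ⟨_, ENNReal.mul_ne_top hA (b := 2 + 4 * ∫⁻ x, decay r x) (by finiteness), fun p => ?_⟩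
    refine lintegral_prod_decay_le hr0 (hm p.1) (fun c => ?_) p.2
    refine le_of_eq_of_le ?_ (lintegral_mul_decay_le_of_same hr0 hα c p.1)
    congr 1
    ext x
    rw [gain, if_pos rfl, show x + (-p.1 - x) = -p.1 by ring, abs_neg,
      show x - (-p.1 - x) = 2 * x + p.1 by ring]
    congr 2
    ring
  · have hβα : β = -α := by
      rcases eq_or_eq_neg_of_abs_eq hα with h | h <;>
      rcases eq_or_eq_neg_of_abs_eq hβ with h' | h' <;> subst h h' <;> simp_all
    refine ⟨_, ENNReal.mul_ne_top hA (b := 4 + 2 * ∫⁻ x, decay r x) (by finiteness), fun p => ?_⟩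
    refine lintegral_prod_decay_le hr0 (hm p.1) (fun c => ?_) p.2
    refine le_of_eq_of_le ?_ (lintegral_mul_decay_le_of_opposite hr0 hα c p.1)
    congr 1
    ext x
    rw [gain, if_neg hαβ, hβα, show (-p.1 - x) ^ 2 = (p.1 + x) ^ 2 by ring]
    congr 2
    ring

/-- The `L²` norm of a `[0, ∞]`-valued function on the plane. -/
def lTwo (f : ℝ × ℝ → ℝ≥0∞) : ℝ≥0∞ := (∫⁻ p, f p ^ 2) ^ (1 / 2 : ℝ)

lemma lTwo_comp_neg (f : ℝ × ℝ → ℝ≥0∞) : lTwo (fun p => f (-p)) = lTwo f := by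
  unfold lTwo
  rw [lintegral_neg_eq_self fun p => f p ^ 2]

/-- Cauchy-Schwarz in `(p, q)`, with `f` grouped with `L` and `g` with `h`: the first factor is
bounded fibrewise over the frozen `p`, and the second splits by translation invariance. -/
lemma lintegral_trilinear_le {L : ℝ × ℝ → ℝ × ℝ → ℝ≥0∞} (hL : Measurable (Function.uncurry L))
    {f g h : ℝ × ℝ → ℝ≥0∞} (hf : Measurable f) (hg : Measurable g) (hh : Measurable h) {C : ℝ≥0∞}
    (hC : ∀ p, ∫⁻ q, L p q ^ 2 ≤ C) :
    ∫⁻ p, ∫⁻ q, L p q * (f p * g q * h (-p - q)) ≤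
      C ^ (1 / 2 : ℝ) * (lTwo f * lTwo g * lTwo h) := by
  have hL' : Measurable fun z : (ℝ × ℝ) × (ℝ × ℝ) => L z.1 z.2 := hL
  have e1 : ∫⁻ z : (ℝ × ℝ) × (ℝ × ℝ), (f z.1 * L z.1 z.2) ^ (2 : ℝ) ∂(volume.prod volume) ≤
      C * ∫⁻ p, f p ^ 2 := by
    simp only [ENNReal.rpow_two, mul_pow]
    rw [lintegral_prod _ (by fun_prop), ← lintegral_const_mul _ (by fun_prop)]
    refine lintegral_mono fun p => ?_
    dsimp only
    rw [lintegral_const_mul _ (by fun_prop), mul_comm]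
    gcongr
    exact hC p
  have e2 : ∫⁻ z : (ℝ × ℝ) × (ℝ × ℝ), (g z.2 * h (-z.1 - z.2)) ^ (2 : ℝ) ∂(volume.prod volume) =
      (∫⁻ p, g p ^ 2) * ∫⁻ p, h p ^ 2 := by
    simp only [ENNReal.rpow_two, mul_pow]
    rw [lintegral_prod_symm _ (by fun_prop), ← lintegral_mul_const _ (by fun_prop)]
    refine lintegral_congr fun q => ?_
    dsimp only
    rw [lintegral_const_mul _ (by fun_prop)]
    congr 1
    rw [lintegral_neg_eq_self (fun p => h (p - q) ^ 2), lintegral_sub_right_eq_self (fun p => h p ^ 2)]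
  calc ∫⁻ p, ∫⁻ q, L p q * (f p * g q * h (-p - q))
      = ∫⁻ z : (ℝ × ℝ) × (ℝ × ℝ), ((fun z : (ℝ × ℝ) × (ℝ × ℝ) => f z.1 * L z.1 z.2) *
          fun z : (ℝ × ℝ) × (ℝ × ℝ) => g z.2 * h (-z.1 - z.2)) z ∂(volume.prod volume) := by
        rw [lintegral_prod _ (by simp only [Pi.mul_def]; fun_prop)]
        refine lintegral_congr fun p => lintegral_congr fun q => ?_
        simp only [Pi.mul_apply]
        ring
    _ ≤ _ := ENNReal.lintegral_mul_le_Lp_mul_Lq _ Real.HolderConjugate.two_two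
          (by fun_prop) (by fun_prop)
    _ ≤ (C * ∫⁻ p, f p ^ 2) ^ (1 / 2 : ℝ) * ((∫⁻ p, g p ^ 2) * ∫⁻ p, h p ^ 2) ^ (1 / 2 : ℝ) := by
        rw [e2]
        gcongr
    _ = _ := by
        rw [ENNReal.mul_rpow_of_nonneg _ _ (by norm_num), ENNReal.mul_rpow_of_nonneg _ _ (by norm_num),
          lTwo, lTwo, lTwo]
        ring

/-- Any two members parametrise the zero-sum triples; here the third member becomes the outer,
frozen variable. -/
lemma lintegral_lintegral_zero_sum {Φ : ℝ × ℝ → ℝ × ℝ → ℝ≥0∞}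
    (hΦ : Measurable (Function.uncurry Φ)) :
    ∫⁻ p, ∫⁻ q, Φ p q = ∫⁻ r, ∫⁻ p, Φ p (-r - p) := by
  have hΦ' : Measurable fun z : (ℝ × ℝ) × (ℝ × ℝ) => Φ z.1 z.2 := hΦ
  rw [lintegral_lintegral_swap (f := fun r p => Φ p (-r - p))]
  · refine lintegral_congr fun p => ?_
    rw [lintegral_neg_eq_self (fun r => Φ p (r - p)), lintegral_sub_right_eq_self (Φ p)]
  · exact (hΦ'.comp (by fun_prop : Measurable fun z : (ℝ × ℝ) × (ℝ × ℝ) =>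
      (z.2, -z.1 - z.2))).aemeasurable

lemma measurable_comp_zero_sum {L : ℝ × ℝ → ℝ × ℝ → ℝ≥0∞}
    (hL : Measurable fun z : (ℝ × ℝ) × (ℝ × ℝ) => L z.1 z.2) :
    Measurable fun z : (ℝ × ℝ) × (ℝ × ℝ) => L (-(z.1 + z.2)) z.1 :=
  hL.comp (by fun_prop : Measurable fun z : (ℝ × ℝ) × (ℝ × ℝ) => (-(z.1 + z.2), z.1))

section
variable {L : ℝ × ℝ → ℝ × ℝ → ℝ≥0∞} {f₀ f₁ f₂ : ℝ × ℝ → ℝ≥0∞} {C : ℝ≥0∞}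

/-- The output is frozen in this version, the first and the second input in the next two. The
function `f₀` is reflected so that the three arguments sum to zero. -/
lemma lintegral_trilinear_le_output
    (hL : Measurable fun z : (ℝ × ℝ) × (ℝ × ℝ) => L z.1 z.2) (m₀ : Measurable f₀)
    (m₁ : Measurable f₁) (m₂ : Measurable f₂) (hC : ∀ p, ∫⁻ q, L p q ^ 2 ≤ C) :
    ∫⁻ p, ∫⁻ q, L (-(p + q)) p * (f₁ p * f₂ q * f₀ (p + q)) ≤
      C ^ (1 / 2 : ℝ) * (lTwo f₀ * lTwo f₁ * lTwo f₂) := by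
  have hL' := measurable_comp_zero_sum hL
  rw [lintegral_lintegral_zero_sum (hL'.mul (by fun_prop)), ← lTwo_comp_neg f₀]
  refine le_of_eq_of_le ?_ (lintegral_trilinear_le hL (m₀.comp measurable_neg) m₁ m₂ hC)
  refine lintegral_congr fun p => lintegral_congr fun q => ?_
  rw [show q + (-p - q) = -p by abel, neg_neg]
  simp only [Function.comp_apply]
  ring

lemma lintegral_trilinear_le_left
    (hL : Measurable fun z : (ℝ × ℝ) × (ℝ × ℝ) => L z.1 z.2) (m₀ : Measurable f₀)
    (m₁ : Measurable f₁) (m₂ : Measurable f₂) (hC : ∀ p, ∫⁻ q, L p q ^ 2 ≤ C) :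
    ∫⁻ p, ∫⁻ q, L p q * (f₁ p * f₂ q * f₀ (p + q)) ≤
      C ^ (1 / 2 : ℝ) * (lTwo f₀ * lTwo f₁ * lTwo f₂) := by
  rw [← lTwo_comp_neg f₀]
  refine le_of_eq_of_le ?_ ((lintegral_trilinear_le hL m₁ m₂ (m₀.comp measurable_neg) hC).trans
    (le_of_eq ?_))
  · refine lintegral_congr fun p => lintegral_congr fun q => ?_
    rw [Function.comp_apply, show -(-p - q) = p + q by abel]
  · simp only [Function.comp_def]
    ring

lemma lintegral_trilinear_le_right
    (hL : Measurable fun z : (ℝ × ℝ) × (ℝ × ℝ) => L z.1 z.2) (m₀ : Measurable f₀)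
    (m₁ : Measurable f₁) (m₂ : Measurable f₂) (hC : ∀ p, ∫⁻ q, L p q ^ 2 ≤ C) :
    ∫⁻ p, ∫⁻ q, L q p * (f₁ p * f₂ q * f₀ (p + q)) ≤
      C ^ (1 / 2 : ℝ) * (lTwo f₀ * lTwo f₁ * lTwo f₂) := by
  have hL' : Measurable fun z : (ℝ × ℝ) × (ℝ × ℝ) => L z.2 z.1 := hL.comp measurable_swap
  rw [lintegral_lintegral_swap (hL'.mul (by fun_prop)).aemeasurable]
  refine le_of_eq_of_le ?_ ((lintegral_trilinear_le_left hL m₀ m₂ m₁ hC).trans (le_of_eq ?_))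
  · refine lintegral_congr fun p => lintegral_congr fun q => ?_
    rw [add_comm q, mul_comm (f₁ q)]
  · ring

end

/-- The square root of `pairKernel` on the plane of frequencies with sum zero. -/
def rootKernel (r α β : ℝ) (p q : ℝ × ℝ) : ℝ≥0∞ := ENNReal.ofReal √(pairKernel r α β q (-p - q))

lemma measurable_rootKernel (r α β : ℝ) :
    Measurable fun z : (ℝ × ℝ) × (ℝ × ℝ) => rootKernel r α β z.1 z.2 :=
  ENNReal.measurable_ofReal.comp (Real.continuous_sqrt.measurable.comp
    ((measurable_pairKernel r α β).comp (by fun_prop :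
      Measurable fun z : (ℝ × ℝ) × (ℝ × ℝ) => (z.2, -z.1 - z.2))))

lemma rootKernel_sq (r α β : ℝ) (p q : ℝ × ℝ) :
    rootKernel r α β p q ^ 2 = ENNReal.ofReal (pairKernel r α β q (-p - q)) := by
  rw [rootKernel, ← ENNReal.ofReal_pow (Real.sqrt_nonneg _),
    Real.sq_sqrt (pairKernel_nonneg _ _ _ _ _)]

/-- The square root is subadditive. Each resulting kernel is written with the frequency whose
modulation is absent as its first, frozen argument. -/
lemma ofReal_le_rootKernel {a₁ a₂ a r C₀ x : ℝ} (p q : ℝ × ℝ)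
    (h : x ^ 2 ≤ C₀ * (pairKernel r a₁ a₂ p q + pairKernel r a a₂ (-(p + q)) q +
      pairKernel r a a₁ (-(p + q)) p)) :
    ENNReal.ofReal x ≤ ENNReal.ofReal √C₀ * (rootKernel r a₁ a₂ (-(p + q)) p +
      rootKernel r a₂ a p q + rootKernel r a₁ a q p) := by
  have k0 := pairKernel_nonneg r a₁ a₂ p q
  have k1 := pairKernel_nonneg r a₂ a q (-p - q)
  have k2 := pairKernel_nonneg r a₁ a p (-q - p)
  have e : x ≤ √C₀ * (√(pairKernel r a₁ a₂ p q) + √(pairKernel r a₂ a q (-p - q)) +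
      √(pairKernel r a₁ a p (-q - p))) := by
    rw [pairKernel_comm r a a₂, pairKernel_comm r a a₁, neg_add'] at h
    rw [show -q - p = -p - q by abel] at k2 ⊢
    refine (le_abs_self _).trans ((Real.abs_le_sqrt h).trans ?_)
    rw [Real.sqrt_mul' _ (by positivity)]
    gcongr
    refine (Real.sqrt_le_left (by positivity)).2 ?_
    have s0 := Real.sq_sqrt k0
    have s1 := Real.sq_sqrt k1
    have s2 := Real.sq_sqrt k2
    have n0 := Real.sqrt_nonneg (pairKernel r a₁ a₂ p q)
    have n1 := Real.sqrt_nonneg (pairKernel r a₂ a q (-p - q))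
    have n2 := Real.sqrt_nonneg (pairKernel r a₁ a p (-p - q))
    nlinarith [mul_nonneg n0 n1, mul_nonneg n0 n2, mul_nonneg n1 n2]
  calc ENNReal.ofReal x ≤ _ := ENNReal.ofReal_le_ofReal e
    _ = _ := by
      rw [ENNReal.ofReal_mul (by positivity), ENNReal.ofReal_add (by positivity) (by positivity),
        ENNReal.ofReal_add (by positivity) (by positivity)]
      simp only [rootKernel, neg_neg, add_sub_cancel_left]

lemma lintegral_lintegral_add_left {A B : ℝ × ℝ → ℝ × ℝ → ℝ≥0∞}
    (hA : Measurable fun z : (ℝ × ℝ) × (ℝ × ℝ) => A z.1 z.2) :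
    ∫⁻ p, ∫⁻ q, (A p q + B p q) = (∫⁻ p, ∫⁻ q, A p q) + ∫⁻ p, ∫⁻ q, B p q := by
  have hA' : Measurable fun p => ∫⁻ q, A p q := hA.lintegral_prod_right'
  rw [← lintegral_add_left hA']
  refine lintegral_congr fun p => ?_
  rw [lintegral_add_left (by fun_prop)]

/-- The trilinear estimate that is dual to the bilinear one. -/
lemma exists_trilinear_le {a₁ a₂ a r C₀ : ℝ} {S : ℝ × ℝ → ℝ × ℝ → ℝ} (h₁ : |a₁| = 1)
    (h₂ : |a₂| = 1) (h₀ : |a| = 1) (hr : 1 < r)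
    (hS : ∀ p q, S p q ^ 2 ≤ C₀ * (pairKernel r a₁ a₂ p q + pairKernel r a a₂ (-(p + q)) q +
      pairKernel r a a₁ (-(p + q)) p)) :
    ∃ C : ℝ≥0∞, C ≠ ∞ ∧ ∀ f₀ f₁ f₂ : ℝ × ℝ → ℝ≥0∞, Measurable f₀ → Measurable f₁ →
      Measurable f₂ → ∫⁻ p, ∫⁻ q, ENNReal.ofReal (S p q) * (f₁ p * f₂ q * f₀ (p + q)) ≤
        C * (lTwo f₀ * lTwo f₁ * lTwo f₂) := by
  obtain ⟨K₀, hK₀, hb₀⟩ := exists_lintegral_pairKernel_le hr h₁ h₂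
  obtain ⟨K₁, hK₁, hb₁⟩ := exists_lintegral_pairKernel_le hr h₂ h₀
  obtain ⟨K₂, hK₂, hb₂⟩ := exists_lintegral_pairKernel_le hr h₁ h₀
  simp only [← rootKernel_sq] at hb₀ hb₁ hb₂
  refine ⟨ENNReal.ofReal √C₀ * (K₀ ^ (1 / 2 : ℝ) + K₁ ^ (1 / 2 : ℝ) + K₂ ^ (1 / 2 : ℝ)),
    by finiteness, fun f₀ f₁ f₂ m₀ m₁ m₂ => ?_⟩
  have hm₀ := measurable_rootKernel r a₁ a₂
  have hm₁ := measurable_rootKernel r a₂ a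
  have hm₂ := measurable_rootKernel r a₁ a
  have hm₀' := measurable_comp_zero_sum hm₀
  have t₀ := lintegral_trilinear_le_output hm₀ m₀ m₁ m₂ hb₀
  have t₁ := lintegral_trilinear_le_left hm₁ m₀ m₁ m₂ hb₁
  have t₂ := lintegral_trilinear_le_right hm₂ m₀ m₁ m₂ hb₂
  calc ∫⁻ p, ∫⁻ q, ENNReal.ofReal (S p q) * (f₁ p * f₂ q * f₀ (p + q))
      ≤ ∫⁻ p, ∫⁻ q, ENNReal.ofReal √C₀ * ((rootKernel r a₁ a₂ (-(p + q)) p * (f₁ p * f₂ q * f₀ (p + q)) +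
          rootKernel r a₂ a p q * (f₁ p * f₂ q * f₀ (p + q))) +
          rootKernel r a₁ a q p * (f₁ p * f₂ q * f₀ (p + q))) := by
        refine lintegral_mono fun p => lintegral_mono fun q => ?_
        refine (mul_le_mul_left (ofReal_le_rootKernel p q (hS p q)) _).trans (le_of_eq ?_)
        ring
    _ = ENNReal.ofReal √C₀ * (((∫⁻ p, ∫⁻ q, rootKernel r a₁ a₂ (-(p + q)) p * (f₁ p * f₂ q * f₀ (p + q))) +
          ∫⁻ p, ∫⁻ q, rootKernel r a₂ a p q * (f₁ p * f₂ q * f₀ (p + q))) +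
          ∫⁻ p, ∫⁻ q, rootKernel r a₁ a q p * (f₁ p * f₂ q * f₀ (p + q))) := by
        simp only [lintegral_const_mul' _ _ ENNReal.ofReal_ne_top]
        rw [lintegral_lintegral_add_left (by fun_prop), lintegral_lintegral_add_left (by fun_prop)]
    _ ≤ ENNReal.ofReal √C₀ * ((K₀ ^ (1 / 2 : ℝ) * (lTwo f₀ * lTwo f₁ * lTwo f₂) +
          K₁ ^ (1 / 2 : ℝ) * (lTwo f₀ * lTwo f₁ * lTwo f₂)) +
          K₂ ^ (1 / 2 : ℝ) * (lTwo f₀ * lTwo f₁ * lTwo f₂)) := by gcongr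
    _ = _ := by ring

/-! ### The bilinear estimates -/

lemma weight_pos (a s b : ℝ) (p : ℝ × ℝ) : 0 < weight a s b p :=
  mul_pos (Real.rpow_pos_of_pos (bracket_pos _) _) (Real.rpow_pos_of_pos (bracket_pos _) _)

/-- The modulus of the weighted transform. -/
def weightedHat (a s b : ℝ) (F : 𝓢(ℝ × ℝ, ℂ)) (p : ℝ × ℝ) : ℝ≥0∞ :=
  ENNReal.ofReal (weight a s b p * ‖hatS F p‖)

lemma measurable_weightedHat (a s b : ℝ) (F : 𝓢(ℝ × ℝ, ℂ)) : Measurable (weightedHat a s b F) :=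
  ENNReal.measurable_ofReal.comp
    ((continuous_weight a s b).mul (hatS F).continuous.norm).measurable

lemma lTwo_weightedHat (a s b : ℝ) (F : 𝓢(ℝ × ℝ, ℂ)) :
    lTwo (weightedHat a s b F) = ENNReal.ofReal (bourgainNorm a s b F) := by
  have h := (memLp_two_iff_integrable_sq_norm (memLp_weight_hat a s b F).1).1
    (memLp_weight_hat a s b F)
  have e (p : ℝ × ℝ) : ‖(weight a s b p : ℂ) * hatS F p‖ ^ 2 =
      bracket (p.2 + a * p.1 ^ 3) ^ (2 * b) * bracket p.1 ^ (2 * s) * ‖hat F p‖ ^ 2 := by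
    rw [norm_mul, Complex.norm_real, Real.norm_of_nonneg (weight_nonneg a s b p), mul_pow, weight_sq,
      hatS_apply]
  have e' (p : ℝ × ℝ) : weightedHat a s b F p ^ 2 =
      ENNReal.ofReal (‖(weight a s b p : ℂ) * hatS F p‖ ^ 2) := by
    rw [weightedHat, norm_mul, Complex.norm_real, Real.norm_of_nonneg (weight_nonneg a s b p),
      ENNReal.ofReal_pow (mul_nonneg (weight_nonneg a s b p) (norm_nonneg _))]
  rw [lTwo, bourgainNorm, Real.sqrt_eq_rpow]
  simp only [← e, e']
  rw [← ofReal_integral_eq_lintegral_ofReal h (.of_forall fun p => by positivity),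
    ENNReal.ofReal_rpow_of_nonneg (integral_nonneg fun p => by positivity) (by norm_num)]

lemma continuous_symbol (a₁ a₂ a s b b' : ℝ) :
    Continuous fun z : (ℝ × ℝ) × (ℝ × ℝ) => symbol a₁ a₂ a s b b' z.1 z.2 := by
  have h₀ := continuous_weight a s b'
  have h₁ := continuous_weight a₁ s b
  have h₂ := continuous_weight a₂ s b
  unfold symbol
  exact Continuous.div (by fun_prop) (by fun_prop)
    fun z => (mul_pos (weight_pos _ _ _ _) (weight_pos _ _ _ _)).ne'

/-- This is the triangle inequality in the convolution formula, with the input weights inserted and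
divided out; the factor `(2π)⁻¹ ≤ 1` is dropped. -/
lemma weightedHat_dxMul_le (a₁ a₂ a s b b' : ℝ) (u v : 𝓢(ℝ × ℝ, ℂ)) (p : ℝ × ℝ) :
    weightedHat a s b' (dxMul u v) p ≤ ∫⁻ q, ENNReal.ofReal (symbol a₁ a₂ a s b b' q (p - q)) *
      (weightedHat a₁ s b u q * weightedHat a₂ s b v (p - q)) := by
  have hw := weight_nonneg a s b' p
  have h1 : ‖hatS (dxMul u v) p‖ ≤ |p.1| * ‖∫ q, hatS u q * hatS v (p - q)‖ := by
    rw [hatS_dxMul]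
    simp only [norm_mul, norm_inv, Complex.norm_I, Complex.norm_real, Real.norm_eq_abs, mul_one,
      Complex.norm_ofNat, abs_of_pos Real.pi_pos]
    gcongr
    refine mul_le_of_le_one_left (abs_nonneg _) (inv_le_one_of_one_le₀ ?_)
    linarith [Real.pi_gt_three]
  calc weightedHat a s b' (dxMul u v) p
      ≤ ENNReal.ofReal ((weight a s b' p * |p.1|) * ‖∫ q, hatS u q * hatS v (p - q)‖) := by
        refine ENNReal.ofReal_le_ofReal ?_
        rw [mul_assoc]
        gcongr
    _ = ENNReal.ofReal (weight a s b' p * |p.1|) * ‖∫ q, hatS u q * hatS v (p - q)‖ₑ := by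
        rw [ENNReal.ofReal_mul (by positivity), ofReal_norm]
    _ ≤ ENNReal.ofReal (weight a s b' p * |p.1|) * ∫⁻ q, ‖hatS u q * hatS v (p - q)‖ₑ := by
        gcongr
        exact enorm_integral_le_lintegral_enorm _
    _ = ∫⁻ q, ENNReal.ofReal (weight a s b' p * |p.1|) * ‖hatS u q * hatS v (p - q)‖ₑ := by
        rw [lintegral_const_mul' _ _ ENNReal.ofReal_ne_top]
    _ = _ := by
        refine lintegral_congr fun q => ?_
        have w₁ := weight_pos a₁ s b q
        have w₂ := weight_pos a₂ s b (p - q)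
        rw [← ofReal_norm, weightedHat, weightedHat, ← ENNReal.ofReal_mul (by positivity),
          ← ENNReal.ofReal_mul (by positivity), ← ENNReal.ofReal_mul, symbol, add_sub_cancel,
          norm_mul]
        · congr 1
          field_simp
        · rw [symbol, add_sub_cancel]
          positivity

/-- Duality by self-testing: with the weighted transform of `(uv)_x` itself as third function, the
trilinear bound reads `N² ≤ C N N₁ N₂`, and the finite norm `N` cancels. All larger constants are
allowed so that the four estimates can share one. -/
lemma exists_dxMulEstimate {a₁ a₂ a s b b' C₀ : ℝ} (h₁ : |a₁| = 1) (h₂ : |a₂| = 1)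
    (h₀ : |a| = 1) (hb : 1 / 2 < b)
    (hS : ∀ p q, symbol a₁ a₂ a s b b' p q ^ 2 ≤ C₀ * (pairKernel (2 * b) a₁ a₂ p q +
      pairKernel (2 * b) a a₂ (-(p + q)) q + pairKernel (2 * b) a a₁ (-(p + q)) p)) :
    ∃ c : ℝ, ∀ c' ≥ c, DxMulEstimate a₁ a₂ a s b b' c' := by
  obtain ⟨C, hC, hT⟩ := exists_trilinear_le h₁ h₂ h₀ (by linarith : 1 < 2 * b) hS
  refine ⟨C.toReal, fun c' hc' => dxMulEstimate_of_schwartz fun u v => ?_⟩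
  have m₀ := measurable_weightedHat a s b' (dxMul u v)
  have m₁ := measurable_weightedHat a₁ s b u
  have m₂ := measurable_weightedHat a₂ s b v
  have hsm : Measurable fun z : (ℝ × ℝ) × (ℝ × ℝ) =>
      ENNReal.ofReal (symbol a₁ a₂ a s b b' z.1 z.2) :=
    ENNReal.measurable_ofReal.comp (continuous_symbol a₁ a₂ a s b b').measurable
  have key : ∫⁻ p, weightedHat a s b' (dxMul u v) p ^ 2 ≤
      ∫⁻ q, ∫⁻ p, ENNReal.ofReal (symbol a₁ a₂ a s b b' q p) *
        (weightedHat a₁ s b u q * weightedHat a₂ s b v p *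
          weightedHat a s b' (dxMul u v) (q + p)) := by
    calc ∫⁻ p, weightedHat a s b' (dxMul u v) p ^ 2
        ≤ ∫⁻ p, ∫⁻ q, ENNReal.ofReal (symbol a₁ a₂ a s b b' q (p - q)) *
            (weightedHat a₁ s b u q * weightedHat a₂ s b v (p - q) *
              weightedHat a s b' (dxMul u v) p) := by
          refine lintegral_mono fun p => ?_
          simp only [← mul_assoc]
          rw [lintegral_mul_const' (weightedHat a s b' (dxMul u v) p) _ ENNReal.ofReal_ne_top, sq]
          gcongr
          simpa only [mul_assoc] using weightedHat_dxMul_le a₁ a₂ a s b b' u v p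
      _ = ∫⁻ q, ∫⁻ p, ENNReal.ofReal (symbol a₁ a₂ a s b b' q (p - q)) *
            (weightedHat a₁ s b u q * weightedHat a₂ s b v (p - q) *
              weightedHat a s b' (dxMul u v) p) := by
          refine lintegral_lintegral_swap (Measurable.aemeasurable ?_)
          exact (hsm.comp (by fun_prop : Measurable fun z : (ℝ × ℝ) × (ℝ × ℝ) =>
            (z.2, z.1 - z.2))).mul (by fun_prop)
      _ = _ := by
          refine lintegral_congr fun q => ?_
          rw [← lintegral_add_left_eq_self _ q]
          simp only [add_sub_cancel_left]
  have hsq : ∫⁻ p, weightedHat a s b' (dxMul u v) p ^ 2 =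
      lTwo (weightedHat a s b' (dxMul u v)) ^ 2 := by
    rw [lTwo, ← ENNReal.rpow_two, ← ENNReal.rpow_mul]
    norm_num
  have hfin := hsq ▸ key.trans (hT _ _ _ m₀ m₁ m₂)
  have n₀ : 0 ≤ bourgainNorm a s b' (dxMul u v) := Real.sqrt_nonneg _
  have n₁ : 0 ≤ bourgainNorm a₁ s b u := Real.sqrt_nonneg _
  have n₂ : 0 ≤ bourgainNorm a₂ s b v := Real.sqrt_nonneg _
  rw [lTwo_weightedHat, lTwo_weightedHat, lTwo_weightedHat, ← ENNReal.ofReal_toReal hC,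
    ← ENNReal.ofReal_pow n₀, ← ENNReal.ofReal_mul n₀, ← ENNReal.ofReal_mul (by positivity),
    ← ENNReal.ofReal_mul ENNReal.toReal_nonneg, ENNReal.ofReal_le_ofReal_iff (by positivity)] at hfin
  refine le_trans ?_ (by gcongr : C.toReal * bourgainNorm a₁ s b u * bourgainNorm a₂ s b v ≤ _)
  rcases n₀.eq_or_lt with h | h
  · rw [← h]; positivity
  · refine le_of_mul_le_mul_left ?_ h
    linarith

end Bourgain

end

/-! ### Choice of exponents and the four sign patterns. -/

theorem proposition3p2 (s : ℝ) (hs : -3 / 4 < s) :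
    ∃ b' ε : ℝ, -1 / 2 < b' ∧ b' < 0 ∧ 0 < ε ∧
      ∀ b : ℝ, 1 / 2 < b → b ≤ b' + 1 → b' + 1 - b ≤ ε →
        ∃ c : ℝ, 0 < c ∧
          Bourgain.DxMulEstimate (-1) (-1) 1 s b b' c ∧
          Bourgain.DxMulEstimate 1 1 (-1) s b b' c ∧
          Bourgain.DxMulEstimate 1 (-1) 1 s b b' c ∧
          Bourgain.DxMulEstimate 1 (-1) (-1) s b b' c := by
  -- For large `s` the value `5/8` serves: it exceeds the `9/16` required by the multiplier bounds
  -- and is below `3/4`.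
  obtain ⟨ρ, h1, h2, h3⟩ : ∃ ρ : ℝ, 5 / 8 ≤ ρ ∧ ρ < 3 / 4 ∧ -ρ ≤ s :=
    ⟨max (-s) (5 / 8), le_max_right _ _, max_lt (by linarith) (by norm_num),
      by linarith [le_max_left (-s) (5 / 8)]⟩
  -- `b' > -1/2` amounts to `modExp ρ < 1`, that is `ρ < 3/4`. The bounds need only `modExp ρ < 1 <
  -- 2b`, so `ε = 1` will do.
  refine ⟨-(Bourgain.modExp ρ / 2), 1, by unfold Bourgain.modExp; linarith, by unfold Bourgain.modExp; linarith, one_pos,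
    fun b hb _ _ => ?_⟩
  have hn : |(-1 : ℝ)| = 1 := by norm_num
  have s₁ := Bourgain.symbol_sq_le_of_output_odd (a := 1) abs_one h1 h2 h3 hb
  have s₂ := Bourgain.symbol_sq_le_of_output_odd (a := -1) hn h1 h2 h3 hb
  have s₃ := Bourgain.symbol_sq_le_of_input_odd (a := 1) abs_one h1 h2 h3 hb
  have s₄ := Bourgain.symbol_sq_le_of_input_odd (a := -1) hn h1 h2 h3 hb
  rw [neg_neg] at s₂ s₄
  obtain ⟨c₁, e₁⟩ := Bourgain.exists_dxMulEstimate hn hn abs_one hb s₁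
  obtain ⟨c₂, e₂⟩ := Bourgain.exists_dxMulEstimate abs_one abs_one hn hb s₂
  obtain ⟨c₃, e₃⟩ := Bourgain.exists_dxMulEstimate hn abs_one abs_one hb s₃
  obtain ⟨c₄, e₄⟩ := Bourgain.exists_dxMulEstimate abs_one hn hn hb s₄
  have l₁ := le_abs_self c₁
  have l₂ := le_abs_self c₂
  have l₃ := le_abs_self c₃
  have l₄ := le_abs_self c₄
  have p₁ := abs_nonneg c₁
  have p₂ := abs_nonneg c₂
  have p₃ := abs_nonneg c₃
  have p₄ := abs_nonneg c₄
  -- The odd input always comes first in the multiplier bound; in the third estimate it is the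
  -- `X^{-1}` factor, so the order is swapped back.
  exact ⟨1 + |c₁| + |c₂| + |c₃| + |c₄|, by positivity, e₁ _ (by linarith), e₂ _ (by linarith),
    (e₃ _ (by linarith)).symm, e₄ _ (by linarith)⟩
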